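/- Let $\mathcal X,\mathcal Y,\mathcal Z$ be finite alphabets with $|\mathcal Y|\ge 2$, let $\mathcal W$ be a set, let $\rho:\mathcal X\times\mathcal W\to[0,\infty)$ be bounded with $\rho_{\max}=\sup\rho$, let $\mu_{XZ}$ be a probability distribution on $\mathcal X\times\mathcal Z$, $\mu_{Y|X}$ a conditional distribution and $f:\mathcal Y\times\mathcal Z\to\mathcal W$; let $(X,Y,Z)$ have the distribution $\mu_{XYZ}(x,y,z)=\mu_{XZ}(x,z)\mu_{Y|X}(y|x)$. All logarithms have base $2$, and $\zeta_{\mathcal U}(\gamma)=\gamma-\sqrt{2\gamma}\log\frac{\sqrt{2\gamma}}{|\mathcal U|}$. **Hash property.** For each $n$ let $\mathcal A_n$ be a set of functions $A:\mathcal Y^n\to\mathcal Y^{l(n)}$, $p_{A,n}$ a probability distribution on $\mathcal A_n$, and $\mathrm{Im}\mathcal A_n=\bigcup_{A\in\mathcal A_n}A(\mathcal Y^n)$. The sequence of ensembles $(\mathcal A_n,p_{A,n})$ has a hash property if $\frac1n\log\frac{|\mathcal Y|^{l(n)}}{|\mathrm{Im}\mathcal A_n|}\to0$ and there are real sequences $\alpha(n)\to1$,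 $\beta(n)\to0$ such that, for all $n$ and all $\mathcal T,\mathcal T'\subset\mathcal Y^n$, $$\sum_{u\in\mathcal T,\,u'\in\mathcal T'}p_{A,n}(\{A:Au=Au'\})\le|\mathcal T\cap\mathcal T'|+\frac{|\mathcal T||\mathcal T'|\alpha(n)}{|\mathrm{Im}\mathcal A_n|}+\min\{|\mathcal T|,|\mathcal T'|\}\beta(n).$$ **Code.** Given $\varepsilon_A,\varepsilon_B>0$, let $l_{\mathcal A}=l_{\mathcal A}(n)$ and $l_{\mathcal B}=l_{\mathcal B}(n)$ be non-negative integers obtained by rounding (up or down, arbitrarily for each $n$) the numbers $\max\{0,\,n[H(Y|X)-\varepsilon_A]/\log|\mathcal Y|\}$ and $n[H(Y|Z)-H(Y|X)+\varepsilon_B]/\log|\mathcal Y|$; a number that is an integer is not changed. For $A:\mathcal Y^n\to\mathcal Y^{l_{\mathcal A}}$, $B:\mathcal Y^n\to\mathcal Y^{l_{\mathcal B}}$ and $c\in\mathcal Y^{l_{\mathcal A}}$, put $$g_A(c|x)\in\arg\max_{y:\,Ay=c}\prod_i\mu_{Y|X}(y_i|x_i),\qquad g_{AB}(c,b|z)\in\arg\max_{y:\,Ay=c,\,By=b}\prod_i\mu_{Y|Z}(y_i|z_i),$$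 where ties are broken, and the value when the constraint set is empty is chosen, by an arbitrary rule fixed in advance ($g_A$ depends only on $n,A,c,x$, and $g_{AB}$ only on $n,A,B,c,b,z$). The encoder is $\varphi(x)=B\,g_A(c|x)$, the decoder is $\varphi^{-1}(b,z)=\big(f(y_i,z_i)\big)_{i=1}^n$ with $y=g_{AB}(c,b|z)$, and the rate is $R(B)=l_{\mathcal B}\log|\mathcal Y|/n$. With $(X^n,Z^n)$ consisting of $n$ independent copies of $(X,Z)$ and $\rho_n(x,w)=\sum_{i=1}^n\rho(x_i,w_i)$, the expected per-letter distortion is $\Delta_n(A,B,c)=\frac1nE\big[\rho_n(X^n,\varphi^{-1}(\varphi(X^n),Z^n))\big]$. **Theorem.** (1) Let $\varepsilon_A,\varepsilon_B>0$ satisfy $\varepsilon_A+2\zeta_{\mathcal Y\times\mathcal Z}(3\varepsilon_A)<\varepsilon_B$, and let the sequences of ensembles $(\mathcal A_n,p_{A,n})$ of functions $\mathcal Y^n\to\mathcal Y^{l_{\mathcal A}}$ and $(\mathcal B_n,p_{B,n})$ of functions $\mathcal Y^n\to\mathcal Y^{l_{\mathcal B}}$ have a hash property. Then for all sufficiently large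 $n$ there are $A\in\mathcal A_n$, $B\in\mathcal B_n$ and $c\in\mathrm{Im}\mathcal A_n$ such that $$R(B)=I(X;Y)-I(Y;Z)+\varepsilon_B$$ up to the rounding of $l_{\mathcal B}$ (the difference of the two sides is less than $\log|\mathcal Y|/n$ in absolute value, and it is $0$ whenever $n[I(X;Y)-I(Y;Z)+\varepsilon_B]/\log|\mathcal Y|$ is an integer), and $$\Delta_n(A,B,c)\le E[\rho(X,f(Y,Z))]+3|\mathcal X||\mathcal Y||\mathcal Z|\,\rho_{\max}\sqrt{\varepsilon_A}.$$ (2) For real $D$, let $R_{X|Z}(D)$ be the infimum of $I(X;Y')-I(Y';Z)$ over all conditional distributions $\mu_{Y'|X}$ on $\mathcal Y$ and all $f':\mathcal Y\times\mathcal Z\to\mathcal W$ with $E[\rho(X,f'(Y',Z))]\le D$, where $(X,Y',Z)$ has the distribution $\mu_{XZ}\mu_{Y'|X}$. Suppose that $(\mu_{Y|X},f)$ attains this bound, that is, $E[\rho(X,f(Y,Z))]\le D$ and $I(X;Y)-I(Y;Z)=R_{X|Z}(D)$. Then for every $\delta>0$ there is $\eta>0$ such that, for all $\varepsilon_A,\varepsilon_B\in(0,\eta)$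 and all ensembles as in (1), for all sufficiently large $n$ the functions $A,B$ and the vector $c$ in (1) can be chosen so that moreover $|R(B)-R_{X|Z}(D)|\le\delta$ and $\Delta_n(A,B,c)\le D+\delta$. -/

import Mathlib

open Filter Topology

noncomputable section

namespace WynerZiv

/-! Finite-alphabet information measures (logarithms to base `2`).  A probability distribution on a
finite set `U` is an element of `stdSimplex ℝ U`. -/

section Information

variable {U V : Type*} [Fintype U] [Fintype V]

/-- Entropy `H(p) = ∑ p(u) log (1 / p(u))`. -/
def entropy (p : U → ℝ) : ℝ := ∑ u, p u * Real.logb 2 (1 / p u)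

/-- First marginal of a joint distribution. -/
def margFst (P : U × V → ℝ) (u : U) : ℝ := ∑ v, P (u, v)

/-- Second marginal of a joint distribution. -/
def margSnd (P : U × V → ℝ) (v : V) : ℝ := ∑ u, P (u, v)

/-- Conditional distribution `μ_{U|V}(u|v)` (with value `0` when `v` has probability zero). -/
def condDist (P : U × V → ℝ) (v : V) (u : U) : ℝ := P (u, v) / margSnd P v

/-- Conditional entropy `H(U|V) = ∑ μ_{U|V}(u|v) μ_V(v) log (1 / μ_{U|V}(u|v))`. -/
def condEntropy (P : U × V → ℝ) : ℝ :=
  ∑ v, ∑ u, condDist P v u * margSnd P v * Real.logb 2 (1 / condDist P v u)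

/-- Mutual information `I(U;V) = H(U) - H(U|V)`. -/
def mutualInfo (P : U × V → ℝ) : ℝ := entropy (margFst P) - condEntropy P

/-- `ζ_U(γ) = γ - √(2γ) log (√(2γ) / |U|)`. -/
def zeta (U : Type*) [Fintype U] (γ : ℝ) : ℝ :=
  γ - Real.sqrt (2 * γ) * Real.logb 2 (Real.sqrt (2 * γ) / Fintype.card U)

end Information

/-! Ensembles of functions and the hash property. -/

/-- An ensemble `(𝒜, p_A)`: a (finite) set of functions `U → V` with a probability distribution
on it. -/
structure Ensemble (U V : Type*) where
  carrier : Finset (U → V)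
  prob : (U → V) → ℝ
  prob_nonneg : ∀ A ∈ carrier, 0 ≤ prob A
  prob_sum : ∑ A ∈ carrier, prob A = 1

namespace Ensemble

variable {U V : Type*}

/-- `Im 𝒜 = ⋃_{A ∈ 𝒜} {A u : u ∈ U}`. -/
def im (E : Ensemble U V) : Set V := ⋃ A ∈ E.carrier, Set.range A

open Classical in
/-- The collision probability `p_A({A : A u = A u'})`. -/
def collisionProb (E : Ensemble U V) (u u' : U) : ℝ :=
  ∑ A ∈ E.carrier.filter (fun A => A u = A u'), E.prob A

end Ensemble

open Classical in
/-- The `(α, β)`-hash property of a sequence (indexed by the block length `n`) of ensembles of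
functions `U^n → V n`. -/
structure HasHashPropertyWith {U : Type*} {V : ℕ → Type*} [∀ n, Fintype (V n)]
    (E : ∀ n, Ensemble (Fin n → U) (V n)) (α β : ℕ → ℝ) : Prop where
  h1 : Tendsto (fun n : ℕ =>
    Real.logb 2 ((Fintype.card (V n) : ℝ) / ((E n).im.ncard : ℝ)) / n) atTop (𝓝 0)
  h2 : Tendsto α atTop (𝓝 1)
  h3 : Tendsto β atTop (𝓝 0)
  h4 : ∀ (n : ℕ) (T T' : Finset (Fin n → U)),
    ∑ u ∈ T, ∑ u' ∈ T', (E n).collisionProb u u' ≤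
      ((T ∩ T').card : ℝ) + (T.card : ℝ) * (T'.card : ℝ) * α n / ((E n).im.ncard : ℝ)
        + min (T.card : ℝ) (T'.card : ℝ) * β n

/-- A sequence of ensembles has a hash property if it has an `(α, β)`-hash property for some
sequences `α` and `β`. -/
def HasHashProperty {U : Type*} {V : ℕ → Type*} [∀ n, Fintype (V n)]
    (E : ∀ n, Ensemble (Fin n → U) (V n)) : Prop :=
  ∃ α β : ℕ → ℝ, HasHashPropertyWith E α β

/-! The Wyner–Ziv setting: `μ = μ_{XZ}` is the joint distribution of source and side information
and `κ x y = μ_{Y|X}(y|x)`. -/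

section Setting

variable {X Y Z W : Type*} [Fintype X] [Fintype Y] [Fintype Z]

/-- `μ_{XYZ}(x,y,z) = μ_{XZ}(x,z) μ_{Y|X}(y|x)`. -/
def joint (μ : X × Z → ℝ) (κ : X → Y → ℝ) (x : X) (y : Y) (z : Z) : ℝ := μ (x, z) * κ x y

/-- The joint distribution `μ_{XY}`. -/
def jointXY (μ : X × Z → ℝ) (κ : X → Y → ℝ) (p : X × Y) : ℝ := ∑ z, joint μ κ p.1 p.2 z

/-- The joint distribution `μ_{YX}`. -/
def jointYX (μ : X × Z → ℝ) (κ : X → Y → ℝ) (p : Y × X) : ℝ := ∑ z, joint μ κ p.2 p.1 z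

/-- The joint distribution `μ_{YZ}`. -/
def jointYZ (μ : X × Z → ℝ) (κ : X → Y → ℝ) (p : Y × Z) : ℝ := ∑ x, joint μ κ x p.1 p.2

/-- `I(X;Y) - I(Y;Z)`. -/
def wzInfo (μ : X × Z → ℝ) (κ : X → Y → ℝ) : ℝ :=
  mutualInfo (jointXY μ κ) - mutualInfo (jointYZ μ κ)

/-- `E_{XYZ}[ρ(X, f(Y,Z))]`. -/
def expDistortion (μ : X × Z → ℝ) (κ : X → Y → ℝ) (ρ : X → W → ℝ) (f : Y → Z → W) : ℝ :=
  ∑ x, ∑ y, ∑ z, joint μ κ x y z * ρ x (f y z)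

/-- The Wyner–Ziv rate-distortion function `R_{X|Z}(D)`: the infimum of `I(X;Y) - I(Y;Z)` over all
conditional distributions `μ_{Y|X}` and functions `f : Y × Z → W` with
`E[ρ(X, f(Y,Z))] ≤ D`. -/
def wzRate (Y : Type*) [Fintype Y] (μ : X × Z → ℝ) (ρ : X → W → ℝ) (D : ℝ) : ℝ :=
  sInf {r : ℝ | ∃ (κ : X → Y → ℝ) (f : Y → Z → W),
    (∀ x, κ x ∈ stdSimplex ℝ Y) ∧ expDistortion μ κ ρ f ≤ D ∧ r = wzInfo μ κ}

/-- `(μ_{Y|X}, f)` attains the Wyner–Ziv bound at distortion level `D`. -/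
def AttainsWZ (μ : X × Z → ℝ) (κ : X → Y → ℝ) (ρ : X → W → ℝ) (f : Y → Z → W) (D : ℝ) : Prop :=
  expDistortion μ κ ρ f ≤ D ∧ wzInfo μ κ = wzRate Y μ ρ D

/-- `ρ_max`. -/
def rhoMax (ρ : X → W → ℝ) : ℝ := ⨆ p : X × W, ρ p.1 p.2

/-- `ρ_n(x, w) = ∑ ρ(x_i, w_i)`. -/
def blockDistortion (ρ : X → W → ℝ) {n : ℕ} (x : Fin n → X) (w : Fin n → W) : ℝ :=
  ∑ i, ρ (x i) (w i)

end Setting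

/-- The value `v` is a possible outcome of `arg max_{v' ∈ S} s(v')`: it maximizes `s` on `S` when
`S` is not empty, and is arbitrary when `S` is empty. -/
def IsArgMax {V : Type*} (S : Set V) (s : V → ℝ) (v : V) : Prop :=
  S.Nonempty → v ∈ S ∧ ∀ v' ∈ S, s v' ≤ s v

/-- The ingredients, for every block length `n`, of the codes for `μ_{XZ} = μ` and
`μ_{Y|X} = κ` with parameters `ε_A`, `ε_B`.

The lengths `l_𝒜 = n [H(Y|X) - ε_A] / log |Y|` and `l_ℬ = n [H(Y|Z) - H(Y|X) + ε_B] / log |Y|`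
are rounded, up or down, to integers (an integer at distance less than one of `t` is `⌊t⌋` or
`⌈t⌉`, and is `t` itself if `t` is an integer); a negative `l_𝒜` is read as `0`.
`gA` and `gAB` are maximum-likelihood coding functions with an arbitrary rule for breaking ties and
for the case of an empty constraint set. -/
structure CodeFamily {X Y Z : Type*} [Fintype X] [Fintype Y] [Fintype Z]
    (μ : X × Z → ℝ) (κ : X → Y → ℝ) (εA εB : ℝ) where
  lenA : ℕ → ℕ
  lenB : ℕ → ℕ
  lenA_spec : ∀ n : ℕ, |(lenA n : ℝ) -
    max (n * (condEntropy (jointYX μ κ) - εA) / Real.logb 2 (Fintype.card Y)) 0| < 1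
  lenB_spec : ∀ n : ℕ, |(lenB n : ℝ) -
    n * (condEntropy (jointYZ μ κ) - condEntropy (jointYX μ κ) + εB)
      / Real.logb 2 (Fintype.card Y)| < 1
  /-- the ensemble of functions `A : Y^n → Y^{l_𝒜}` -/
  ensA : ∀ n, Ensemble (Fin n → Y) (Fin (lenA n) → Y)
  /-- the ensemble of functions `B : Y^n → Y^{l_ℬ}` -/
  ensB : ∀ n, Ensemble (Fin n → Y) (Fin (lenB n) → Y)
  /-- `g_A(c|x)` -/
  gA : ∀ n, ((Fin n → Y) → (Fin (lenA n) → Y)) → (Fin (lenA n) → Y) → (Fin n → X) → (Fin n → Y)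
  gA_spec : ∀ n A c x, IsArgMax {y | A y = c} (fun y => ∏ i, κ (x i) (y i)) (gA n A c x)
  /-- `g_{AB}(c,b|z)` -/
  gAB : ∀ n, ((Fin n → Y) → (Fin (lenA n) → Y)) → ((Fin n → Y) → (Fin (lenB n) → Y)) →
    (Fin (lenA n) → Y) → (Fin (lenB n) → Y) → (Fin n → Z) → (Fin n → Y)
  gAB_spec : ∀ n A B c b z, IsArgMax {y | A y = c ∧ B y = b}
    (fun y => ∏ i, condDist (jointYZ μ κ) (z i) (y i)) (gAB n A B c b z)

namespace CodeFamily

variable {X Y Z W : Type*} [Fintype X] [Fintype Y] [Fintype Z]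
  {μ : X × Z → ℝ} {κ : X → Y → ℝ} {εA εB : ℝ}

/-- The encoder `φ(x) = B g_A(c|x)`. -/
def encode (C : CodeFamily μ κ εA εB) {n : ℕ} (A : (Fin n → Y) → (Fin (C.lenA n) → Y))
    (B : (Fin n → Y) → (Fin (C.lenB n) → Y)) (c : Fin (C.lenA n) → Y) (x : Fin n → X) :
    Fin (C.lenB n) → Y :=
  B (C.gA n A c x)

/-- The decoder `φ⁻¹(b|z) = f_n(g_{AB}(c,b|z), z)`. -/
def decode (C : CodeFamily μ κ εA εB) (f : Y → Z → W) {n : ℕ}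
    (A : (Fin n → Y) → (Fin (C.lenA n) → Y)) (B : (Fin n → Y) → (Fin (C.lenB n) → Y))
    (c : Fin (C.lenA n) → Y) (b : Fin (C.lenB n) → Y) (z : Fin n → Z) : Fin n → W :=
  fun i => f (C.gAB n A B c b z i) (z i)

/-- The rate `R(B) = l_ℬ log |Y| / n`. -/
def rate (C : CodeFamily μ κ εA εB) (n : ℕ) : ℝ :=
  (C.lenB n : ℝ) * Real.logb 2 (Fintype.card Y) / n

/-- The expected per-letter distortion `E_{XZ}[ρ_n(X^n, φ⁻¹(φ(X^n), Z^n))] / n`, where `(X^n, Z^n)`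
consists of `n` independent pairs with distribution `μ_{XZ}`. -/
def distortion (C : CodeFamily μ κ εA εB) (ρ : X → W → ℝ) (f : Y → Z → W) {n : ℕ}
    (A : (Fin n → Y) → (Fin (C.lenA n) → Y)) (B : (Fin n → Y) → (Fin (C.lenB n) → Y))
    (c : Fin (C.lenA n) → Y) : ℝ :=
  (∑ x : Fin n → X, ∑ z : Fin n → Z,
    (∏ i, μ (x i, z i)) * blockDistortion ρ x (C.decode f A B c (C.encode A B c x) z)) / n

/-- The rate and distortion guarantees at block length `n`.  The rate is
`I(X;Y) - I(Y;Z) + ε_B` up to the rounding of the code length, and exactly so whenever the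
unrounded length is an integer. -/
def Achieves (C : CodeFamily μ κ εA εB) (ρ : X → W → ℝ) (f : Y → Z → W) {n : ℕ}
    (A : (Fin n → Y) → (Fin (C.lenA n) → Y)) (B : (Fin n → Y) → (Fin (C.lenB n) → Y))
    (c : Fin (C.lenA n) → Y) : Prop :=
  |C.rate n - (wzInfo μ κ + εB)| < Real.logb 2 (Fintype.card Y) / n ∧
  ((∃ k : ℕ, (k : ℝ) = n * (wzInfo μ κ + εB) / Real.logb 2 (Fintype.card Y)) →
    C.rate n = wzInfo μ κ + εB) ∧
  C.distortion ρ f A B c ≤ expDistortion μ κ ρ f +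
    3 * Fintype.card X * Fintype.card Y * Fintype.card Z * rhoMax ρ * Real.sqrt εA

end CodeFamily

end WynerZiv

end

set_option linter.unusedSectionVars false

namespace WynerZiv

/-! The proof is by random coding: `A`, `B` and `c` are independent, `A` and `B` follow the
ensembles and `c` is uniform on `Im 𝒜`. If the mean distortion is small, some triple does at least
as well. The work is in natural logarithms, with `e = εA * log 2` and a small typicality parameter
`t`.

Encoder. There are about `exp (n H(Y|X))` sequences `y` of typical likelihood given `x`, more than
`|Im 𝒜| ≈ exp (n (H(Y|X) - e))`. By saturation (`Ensemble.sum_prob_empty_le`) the bin `A y = c`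
usually contains one, so the maximum-likelihood choice is at least about as likely. Conversely, by
the method of types (`card_empEntropy_le`), the `y` whose conditional type has entropy below `H(Y|X)
- e - t` are too few to hit a random bin. Cross entropy bounded above and entropy bounded below give
a divergence between the conditional type of `y` given `x` and `κ` of at most about `e`
(`condDiv_empCond_le`). A Hellinger form of Pinsker's inequality turns this into a variational
distance of about `√e < √εA`, which controls the distortion.

Decoder. The encoder does not see `z`, so given `x` the letters of `z` are independent of `y`, and
Chebyshev makes the triple conditionally typical. Continuity of entropy then bounds the information
content of `y` given `z` (`sum_jointYZ_mul_neg_log_condDist_le`). A wrong decoder output is at least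
as likely as `y`, lies in a list of controlled size, and shares both bins with `y`. Collision
resistance (`sum_codeWeight_collision_le`) makes this rare once `|Im 𝒜| |Im ℬ|` beats the list size.
The hypothesis on `zeta` ensures this through `zeta_bound`.

`blockDistortion_code_le` combines the five error events for a single source pair, `exists_code`
averages over codes, and `eventually_exists_distortion_le` lets `n` grow. The rate is a matter of
rounding and the identity `I(X;Y) - I(Y;Z) = H(Y|Z) - H(Y|X)`. -/

/-! ### Product distributions and Chebyshev's inequality. -/

theorem sum_prod_eq_prod_sum {U : Type*} [Fintype U] {n : ℕ} (P : Fin n → U → ℝ) :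
    ∑ u : Fin n → U, ∏ i, P i (u i) = ∏ i, ∑ a, P i a := by
  classical
  rw [Finset.prod_univ_sum, Fintype.piFinset_univ]

theorem sum_prod_eq_one {U : Type*} [Fintype U] {n : ℕ} (P : Fin n → U → ℝ)
    (hP : ∀ i, ∑ a, P i a = 1) : ∑ u : Fin n → U, ∏ i, P i (u i) = 1 := by
  rw [sum_prod_eq_prod_sum]
  simp [hP]

theorem sum_fin_succ_pi {U : Type*} [Fintype U] {n : ℕ} (F : (Fin (n + 1) → U) → ℝ) :
    ∑ u, F u = ∑ a, ∑ u : Fin n → U, F (Fin.cons a u) := by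
  rw [← Fintype.sum_prod_type']
  exact (Fintype.sum_equiv (Fin.consEquiv fun _ : Fin (n + 1) => U) _ _ (fun _ => rfl)).symm

theorem sum_prod_mul_sum_eq_zero {U : Type*} [Fintype U] : ∀ {n : ℕ} (P h : Fin n → U → ℝ)
    (_ : ∀ i, ∑ a, P i a = 1) (_ : ∀ i, ∑ a, P i a * h i a = 0),
    ∑ u : Fin n → U, (∏ i, P i (u i)) * ∑ i, h i (u i) = 0 := by
  intro n
  induction n with
  | zero => intro P h _ _; simp
  | succ n ih =>
    intro P h hP hh
    rw [sum_fin_succ_pi]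
    have key : ∀ a, ∑ u : Fin n → U, (∏ i, P i ((Fin.cons a u : Fin (n + 1) → U) i)) *
        ∑ i, h i ((Fin.cons a u : Fin (n + 1) → U) i) = P 0 a * h 0 a := by
      intro a
      simp only [Fin.prod_univ_succ, Fin.sum_univ_succ, Fin.cons_zero, Fin.cons_succ]
      have h1 := ih (fun i => P i.succ) (fun i => h i.succ) (fun i => hP _) (fun i => hh _)
      have h2 := sum_prod_eq_one (fun i : Fin n => P i.succ) (fun i => hP _)
      calc _ = ∑ u : Fin n → U, (P 0 a * h 0 a * (∏ i, P (Fin.succ i) (u i)) +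
            P 0 a * ((∏ i, P (Fin.succ i) (u i)) * ∑ i, h (Fin.succ i) (u i))) :=
              Finset.sum_congr rfl fun u _ => by ring
        _ = _ := by
              rw [Finset.sum_add_distrib, ← Finset.mul_sum, ← Finset.mul_sum, h1, h2]; ring
    simp only [key, hh]

/-- Variances of independent centred terms add: on splitting off the first letter, the cross term
vanishes by `sum_prod_mul_sum_eq_zero`. -/
theorem sum_prod_mul_sum_sq {U : Type*} [Fintype U] : ∀ {n : ℕ} (P h : Fin n → U → ℝ)
    (_ : ∀ i, ∑ a, P i a = 1) (_ : ∀ i, ∑ a, P i a * h i a = 0),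
    ∑ u : Fin n → U, (∏ i, P i (u i)) * (∑ i, h i (u i)) ^ 2 = ∑ i, ∑ a, P i a * h i a ^ 2 := by
  intro n
  induction n with
  | zero => intro P h _ _; simp
  | succ n ih =>
    intro P h hP hh
    rw [sum_fin_succ_pi]
    have h1 := ih (fun i => P i.succ) (fun i => h i.succ) (fun i => hP _) (fun i => hh _)
    have h2 := sum_prod_eq_one (fun i : Fin n => P i.succ) (fun i => hP _)
    have h3 := sum_prod_mul_sum_eq_zero (fun i : Fin n => P i.succ) (fun i => h i.succ)
      (fun i => hP _) (fun i => hh _)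
    have key : ∀ a, ∑ u : Fin n → U, (∏ i, P i ((Fin.cons a u : Fin (n + 1) → U) i)) *
        (∑ i, h i ((Fin.cons a u : Fin (n + 1) → U) i)) ^ 2 =
        P 0 a * h 0 a ^ 2 + P 0 a * ∑ i : Fin n, ∑ a, P i.succ a * h i.succ a ^ 2 := by
      intro a
      simp only [Fin.prod_univ_succ, Fin.sum_univ_succ, Fin.cons_zero, Fin.cons_succ]
      calc _ = ∑ u : Fin n → U, (P 0 a * h 0 a ^ 2 * (∏ i, P (Fin.succ i) (u i)) +
            2 * P 0 a * h 0 a * ((∏ i, P (Fin.succ i) (u i)) * ∑ i, h (Fin.succ i) (u i)) +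
            P 0 a * ((∏ i, P (Fin.succ i) (u i)) * (∑ i, h (Fin.succ i) (u i)) ^ 2)) :=
              Finset.sum_congr rfl fun u _ => by ring
        _ = _ := by
              rw [Finset.sum_add_distrib, Finset.sum_add_distrib, ← Finset.mul_sum,
                ← Finset.mul_sum, ← Finset.mul_sum, h1, h2, h3]; ring
    simp only [key]
    rw [Finset.sum_add_distrib, ← Finset.sum_mul, hP, Fin.sum_univ_succ]
    ring

/-- Chebyshev's inequality for a sum of independent bounded terms. -/
theorem chebyshev_prod {U : Type*} [Fintype U] {n : ℕ} (hn : 0 < n) (P g : Fin n → U → ℝ)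
    (hP : ∀ i, P i ∈ stdSimplex ℝ U) {G t : ℝ} (hG : ∀ i a, |g i a| ≤ G) (ht : 0 < t)
    (S : Finset (Fin n → U))
    (hS : ∀ u ∈ S, t * n ≤ |∑ i, g i (u i) - ∑ i, ∑ a, P i a * g i a|) :
    ∑ u ∈ S, ∏ i, P i (u i) ≤ G ^ 2 / (n * t ^ 2) := by
  have hn' : (0 : ℝ) < n := by exact_mod_cast hn
  have hpos : ∀ u : Fin n → U, 0 ≤ ∏ i, P i (u i) :=
    fun u => Finset.prod_nonneg fun i _ => (hP i).1 _
  set h : Fin n → U → ℝ := fun i a => g i a - ∑ a, P i a * g i a with hh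
  have hmean : ∀ i, ∑ a, P i a * h i a = 0 := by
    intro i
    simp only [hh, mul_sub, Finset.sum_sub_distrib, ← Finset.sum_mul, (hP i).2, one_mul, sub_self]
  have hvar : ∀ i, ∑ a, P i a * h i a ^ 2 ≤ G ^ 2 := by
    intro i
    set m := ∑ a, P i a * g i a with hm
    have e : ∑ a, P i a * h i a ^ 2 = ∑ a, P i a * g i a ^ 2 - m ^ 2 := by
      calc _ = ∑ a, (P i a * g i a ^ 2 - 2 * m * (P i a * g i a) + m ^ 2 * P i a) :=
            Finset.sum_congr rfl fun a _ => by simp only [hh]; ring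
        _ = _ := by
            rw [Finset.sum_add_distrib, Finset.sum_sub_distrib, ← Finset.mul_sum,
              ← Finset.mul_sum, (hP i).2, ← hm]; ring
    have : ∑ a, P i a * g i a ^ 2 ≤ ∑ a, P i a * G ^ 2 :=
      Finset.sum_le_sum fun a _ => mul_le_mul_of_nonneg_left
        (sq_le_sq.2 ((hG i a).trans (le_abs_self _))) ((hP i).1 a)
    rw [← Finset.sum_mul, (hP i).2, one_mul] at this
    rw [e]; nlinarith [sq_nonneg m]
  have h2 := sum_prod_mul_sum_sq P h (fun i => (hP i).2) hmean
  have h3 : ∑ i, ∑ a, P i a * h i a ^ 2 ≤ n * G ^ 2 := by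
    refine (Finset.sum_le_sum fun i _ => hvar i).trans ?_
    simp
  have h4 : (t * n) ^ 2 * ∑ u ∈ S, ∏ i, P i (u i) ≤
      ∑ u : Fin n → U, (∏ i, P i (u i)) * (∑ i, h i (u i)) ^ 2 := by
    rw [Finset.mul_sum]
    refine (Finset.sum_le_sum fun u hu => ?_).trans (Finset.sum_le_univ_sum_of_nonneg
      (fun u => mul_nonneg (hpos u) (sq_nonneg _)))
    rw [mul_comm]
    refine mul_le_mul_of_nonneg_left ?_ (hpos u)
    have := hS u hu
    simp only [hh, Finset.sum_sub_distrib]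
    exact sq_le_sq.2 (by rwa [abs_of_nonneg (by positivity)])
  rw [le_div_iff₀ (by positivity)]
  have h5 : (t * n) ^ 2 * ∑ u ∈ S, ∏ i, P i (u i) ≤ n * G ^ 2 := by linarith
  have : n * ((∑ u ∈ S, ∏ i, P i (u i)) * (n * t ^ 2)) ≤ n * G ^ 2 := by
    calc _ = (t * n) ^ 2 * ∑ u ∈ S, ∏ i, P i (u i) := by ring
      _ ≤ _ := h5
  exact le_of_mul_le_mul_left this hn'

/-! ### Continuity of entropy, and divergence inequalities (natural logarithms). -/

open Real in
theorem negMulLog_add_le {a b : ℝ} (ha : 0 ≤ a) (hb : 0 ≤ b) :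
    negMulLog (a + b) ≤ negMulLog a + negMulLog b := by
  rcases ha.eq_or_lt with rfl | ha
  · simp
  rcases hb.eq_or_lt with rfl | hb
  · simp
  simp only [negMulLog]
  have h1 : log a ≤ log (a + b) := log_le_log ha (by linarith)
  have h2 : log b ≤ log (a + b) := log_le_log hb (by linarith)
  nlinarith

-- The free parameter `c` comes from the tangent bound `log (c / d) ≤ c / d - 1` with `d = a - b`,
-- which avoids monotonicity conditions on `d log (1 / d)`. The term `b - a` is kept because it
-- cancels when summed over two probability distributions.
open Real in
theorem negMulLog_sub_le {a b c : ℝ} (ha : 0 ≤ a) (hb : 0 ≤ b) (hb1 : b ≤ 1) (hc : 0 < c) :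
    negMulLog a - negMulLog b ≤ max (a - b) 0 * log (1 / c) + c + (b - a) := by
  rcases le_total b a with h | h
  · rw [max_eq_left (by linarith)]
    have h1 := negMulLog_add_le hb (sub_nonneg.2 h)
    rw [add_sub_cancel] at h1
    rcases (sub_nonneg.2 h).eq_or_lt with h0 | h0
    · have : a = b := by linarith
      subst this; simp; exact hc.le
    have h2 : log (c / (a - b)) ≤ c / (a - b) - 1 := log_le_sub_one_of_pos (by positivity)
    rw [log_div hc.ne' h0.ne'] at h2
    have h3 : (a - b) * (log c - log (a - b)) ≤ c - (a - b) := by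
      calc _ ≤ (a - b) * (c / (a - b) - 1) := mul_le_mul_of_nonneg_left h2 h0.le
        _ = _ := by field_simp
    have h4 : negMulLog (a - b) = -((a - b) * log (a - b)) := by rw [negMulLog]; ring
    rw [one_div, log_inv]
    linarith
  · rw [max_eq_right (by linarith), zero_mul, zero_add]
    suffices negMulLog a - negMulLog b ≤ b - a by linarith
    rcases ha.eq_or_lt with rfl | ha
    · have := mul_nonneg hb (neg_nonneg.2 (log_nonpos hb hb1))
      simp only [negMulLog]
      linarith
    have hb0 : 0 < b := by linarith
    have h1 : log (b / a) ≤ b / a - 1 := log_le_sub_one_of_pos (by positivity)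
    rw [log_div hb0.ne' ha.ne'] at h1
    have h2 : a * (log b - log a) ≤ b - a := by
      calc _ ≤ a * (b / a - 1) := mul_le_mul_of_nonneg_left h1 ha.le
        _ = _ := by field_simp
    have h3 : (b - a) * log b ≤ 0 :=
      mul_nonpos_of_nonneg_of_nonpos (by linarith) (log_nonpos hb hb1)
    simp only [negMulLog]
    linarith

/-- A bound for the difference of the entropies of two distributions in terms of their variational
distance, with a free parameter `s`. -/
theorem sum_negMulLog_sub_le {U : Type*} [Fintype U] [Nonempty U] {P Q : U → ℝ}
    (hP : P ∈ stdSimplex ℝ U) (hQ : Q ∈ stdSimplex ℝ U) {s : ℝ} (hs : 0 < s) :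
    ∑ u, Real.negMulLog (P u) - ∑ u, Real.negMulLog (Q u) ≤
      (∑ u, max (P u - Q u) 0) * Real.log (Fintype.card U / s) + s := by
  have hK : (0 : ℝ) < Fintype.card U := by exact_mod_cast Fintype.card_pos
  rw [← Finset.sum_sub_distrib]
  -- With `c = s / |U|` the additive errors `c` sum to `s`.
  refine (Finset.sum_le_sum fun u _ => negMulLog_sub_le (c := s / Fintype.card U) (hP.1 u) (hQ.1 u)
    ((Finset.single_le_sum (fun i _ => hQ.1 i) (Finset.mem_univ u)).trans hQ.2.le)
    (by positivity)).trans ?_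
  rw [Finset.sum_add_distrib, Finset.sum_add_distrib, Finset.sum_sub_distrib, hP.2, hQ.2,
    ← Finset.sum_mul, one_div_div]
  simp only [Finset.sum_const, Finset.card_univ, nsmul_eq_mul]
  rw [mul_div_cancel₀ _ hK.ne']
  linarith

theorem sum_max_sub_eq {U : Type*} [Fintype U] {P Q : U → ℝ} (h : ∑ u, P u = ∑ u, Q u) :
    ∑ u, max (P u - Q u) 0 = (∑ u, |P u - Q u|) / 2 := by
  have : ∀ u, max (P u - Q u) 0 = (|P u - Q u| + (P u - Q u)) / 2 := by
    intro u
    rcases le_total 0 (P u - Q u) with h | h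
    · rw [max_eq_left h, abs_of_nonneg h]; ring
    · rw [max_eq_right h, abs_of_nonpos h]; ring
  simp only [this, ← Finset.sum_div, Finset.sum_add_distrib, Finset.sum_sub_distrib, h]
  ring

-- This is `log v ≤ v - 1` at `v = √b / √a`. Summed over two distributions it bounds the squared
-- Hellinger distance by the divergence.
open Real in
theorem sq_sqrt_sub_sqrt_le_mul_log {a b : ℝ} (ha : 0 ≤ a) (hb : 0 ≤ b) (hab : b = 0 → a = 0) :
    (√a - √b) ^ 2 + a - b ≤ a * log (a / b) := by
  rcases ha.eq_or_lt with rfl | ha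
  · simp [sq_sqrt hb]
  have hb : 0 < b := hb.lt_of_ne fun h => ha.ne' (hab h.symm)
  have hsa := sqrt_pos.2 ha
  have hsb := sqrt_pos.2 hb
  have h1 : log (√b / √a) ≤ √b / √a - 1 := log_le_sub_one_of_pos (by positivity)
  rw [log_div hsb.ne' hsa.ne', log_sqrt ha.le, log_sqrt hb.le] at h1
  rw [log_div ha.ne' hb.ne']
  have h2 : a * (√b / √a) = √a * √b := by
    rw [mul_div_assoc', div_eq_iff hsa.ne']
    linear_combination √b * -(mul_self_sqrt ha.le)
  have h3 := mul_le_mul_of_nonneg_left h1 ha.le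
  have h4 := sq_sqrt ha.le
  have h5 := sq_sqrt hb.le
  nlinarith

/-- The variational distance is bounded by the square root of the divergence (in nats). -/
theorem sum_max_sub_le_sqrt {U : Type*} [Fintype U] {P Q : U → ℝ}
    (hP : P ∈ stdSimplex ℝ U) (hQ : Q ∈ stdSimplex ℝ U) (hPQ : ∀ u, Q u = 0 → P u = 0) :
    ∑ u, max (P u - Q u) 0 ≤ √(∑ u, P u * Real.log (P u / Q u)) := by
  rw [sum_max_sub_eq (hP.2.trans hQ.2.symm)]
  apply Real.le_sqrt_of_sq_le
  have h1 : ∑ u, (√(P u) - √(Q u)) ^ 2 ≤ ∑ u, P u * Real.log (P u / Q u) := by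
    have := Finset.sum_le_sum fun u (_ : u ∈ Finset.univ) =>
      sq_sqrt_sub_sqrt_le_mul_log (hP.1 u) (hQ.1 u) (hPQ u)
    rw [Finset.sum_sub_distrib, Finset.sum_add_distrib, hP.2, hQ.2] at this
    linarith
  have h2 : ∑ u, (√(P u) + √(Q u)) ^ 2 ≤ 4 := by
    have : ∀ u, (√(P u) + √(Q u)) ^ 2 ≤ 2 * P u + 2 * Q u := fun u => by
      have := Real.sq_sqrt (hP.1 u)
      have := Real.sq_sqrt (hQ.1 u)
      nlinarith [sq_nonneg (√(P u) - √(Q u))]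
    refine (Finset.sum_le_sum fun u _ => this u).trans ?_
    rw [Finset.sum_add_distrib, ← Finset.mul_sum, ← Finset.mul_sum, hP.2, hQ.2]
    norm_num
  have h3 : ∑ u, |P u - Q u| = ∑ u, |√(P u) - √(Q u)| * (√(P u) + √(Q u)) := by
    refine Finset.sum_congr rfl fun u _ => ?_
    rw [← abs_of_nonneg (add_nonneg (Real.sqrt_nonneg (P u)) (Real.sqrt_nonneg (Q u))), ← abs_mul]
    congr 1
    linear_combination -(Real.mul_self_sqrt (hP.1 u)) + Real.mul_self_sqrt (hQ.1 u)
  -- Cauchy–Schwarz: the squared `ℓ¹` distance is at most four times the divergence, and the 4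
  -- cancels against halving.
  have h4 := Finset.sum_mul_sq_le_sq_mul_sq Finset.univ (fun u => |√(P u) - √(Q u)|)
    (fun u => √(P u) + √(Q u))
  simp only [sq_abs] at h4
  rw [h3]
  have h5 : 0 ≤ ∑ u, (√(P u) - √(Q u)) ^ 2 := Finset.sum_nonneg fun _ _ => sq_nonneg _
  rw [div_pow]
  nlinarith

/-- The log-sum inequality. -/
theorem sum_mul_log_sum_div_sum_le {U : Type*} [Fintype U] {P Q : U → ℝ}
    (hP : ∀ u, 0 ≤ P u) (hQ : ∀ u, 0 ≤ Q u) (hPQ : ∀ u, Q u = 0 → P u = 0) :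
    (∑ u, P u) * Real.log ((∑ u, P u) / ∑ u, Q u) ≤ ∑ u, P u * Real.log (P u / Q u) := by
  have hP0 : 0 ≤ ∑ u, P u := Finset.sum_nonneg fun u _ => hP u
  have hQ0 : 0 ≤ ∑ u, Q u := Finset.sum_nonneg fun u _ => hQ u
  rcases hP0.eq_or_lt with h | hp
  · have : ∀ u, P u = 0 := fun u =>
      (Finset.sum_eq_zero_iff_of_nonneg fun u _ => hP u).1 h.symm u (Finset.mem_univ u)
    simp [this]
  have hq : 0 < ∑ u, Q u := by
    refine hQ0.lt_of_ne fun h => hp.ne' (Finset.sum_eq_zero fun u hu => hPQ u ?_)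
    exact (Finset.sum_eq_zero_iff_of_nonneg fun u _ => hQ u).1 h.symm u hu
  set p := ∑ u, P u with hpd
  set q := ∑ u, Q u with hqd
  -- Termwise tangent bound; the corrections `P u - Q u * (p / q)` sum to zero.
  have key : ∀ u, P u * Real.log (p / q) + (P u - Q u * (p / q)) ≤ P u * Real.log (P u / Q u) := by
    intro u
    rcases (hP u).eq_or_lt with h | h
    · rw [← h]
      have := mul_nonneg (hQ u) (div_pos hp hq).le
      linarith
    have hQu : 0 < Q u := (hQ u).lt_of_ne fun h' => h.ne' (hPQ u h'.symm)
    have h1 : Real.log (Q u * (p / q) / P u) ≤ Q u * (p / q) / P u - 1 :=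
      Real.log_le_sub_one_of_pos (by positivity)
    rw [Real.log_div (by positivity) h.ne', Real.log_mul hQu.ne' (by positivity)] at h1
    rw [Real.log_div h.ne' hQu.ne']
    have h2 := mul_le_mul_of_nonneg_left h1 h.le
    have h3 : P u * (Q u * (p / q) / P u - 1) = Q u * (p / q) - P u := by field_simp
    linarith
  have := Finset.sum_le_sum fun u (_ : u ∈ Finset.univ) => key u
  rw [Finset.sum_add_distrib, Finset.sum_sub_distrib, ← Finset.sum_mul, ← Finset.sum_mul, ← hpd,
    ← hqd, mul_div_cancel₀ _ hq.ne'] at this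
  linarith

/-! ### Single-letter consequences of a small conditional divergence. -/

section SingleLetter

variable {X Y Z W : Type*} [Fintype X] [Fintype Y] [Fintype Z]

theorem jointYZ_mem_stdSimplex {μ : X × Z → ℝ} (hμ : μ ∈ stdSimplex ℝ (X × Z)) {V : X → Y → ℝ}
    (hV : ∀ x, V x ∈ stdSimplex ℝ Y) : jointYZ μ V ∈ stdSimplex ℝ (Y × Z) := by
  refine ⟨fun p => Finset.sum_nonneg fun x _ => mul_nonneg (hμ.1 _) ((hV x).1 _), ?_⟩
  rw [← hμ.2, Fintype.sum_prod_type_right, Fintype.sum_prod_type_right]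
  refine Finset.sum_congr rfl fun z _ => ?_
  simp only [jointYZ, joint]
  rw [Finset.sum_comm]
  simp only [← Finset.mul_sum, (hV _).2, mul_one]

theorem margSnd_jointYZ (μ : X × Z → ℝ) {V : X → Y → ℝ}
    (hV : ∀ x, V x ∈ stdSimplex ℝ Y) (z : Z) : margSnd (jointYZ μ V) z = ∑ x, μ (x, z) := by
  simp only [margSnd, jointYZ, joint]
  rw [Finset.sum_comm]
  simp only [← Finset.mul_sum, (hV _).2, mul_one]

theorem condDist_mul_margSnd {U V : Type*} [Fintype U] [Fintype V] {P : U × V → ℝ}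
    (hP : ∀ p, 0 ≤ P p) (u : U) (v : V) : condDist P v u * margSnd P v = P (u, v) := by
  unfold condDist
  by_cases h : margSnd P v = 0
  · rw [h, mul_zero]
    exact ((Finset.sum_eq_zero_iff_of_nonneg fun u _ => hP (u, v)).1 h u (Finset.mem_univ u)).symm
  · rw [div_mul_cancel₀ _ h]

theorem condEntropy_mul_log_two {U V : Type*} [Fintype U] [Fintype V] {P : U × V → ℝ}
    (hP : ∀ p, 0 ≤ P p) :
    condEntropy P * Real.log 2 = ∑ v, ∑ u, P (u, v) * -Real.log (condDist P v u) := by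
  have h2 : Real.log 2 ≠ 0 := (Real.log_pos (by norm_num)).ne'
  rw [condEntropy, Finset.sum_mul]
  refine Finset.sum_congr rfl fun v _ => ?_
  rw [Finset.sum_mul]
  refine Finset.sum_congr rfl fun u _ => ?_
  rw [condDist_mul_margSnd hP, one_div, Real.logb, Real.log_inv]
  field_simp

/-- The divergence `D(V ‖ κ | p)` in nats. -/
noncomputable def condDiv (p : X → ℝ) (V κ : X → Y → ℝ) : ℝ :=
  ∑ x, p x * ∑ y, V x y * Real.log (V x y / κ x y)

variable {μ : X × Z → ℝ} {p : X → ℝ} {w : X → Z → ℝ} {V κ : X → Y → ℝ}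

/-- Since `p` cancels in the likelihood ratio, the divergence of the two joint distributions on `X ×
Y` is `condDiv`. -/
theorem sum_max_mul_sub_le (hp : p ∈ stdSimplex ℝ X) (hV : ∀ x, V x ∈ stdSimplex ℝ Y)
    (hκ : ∀ x, κ x ∈ stdSimplex ℝ Y) (hVκ : ∀ x y, κ x y = 0 → V x y = 0) :
    ∑ x, ∑ y, max (p x * V x y - p x * κ x y) 0 ≤ √(condDiv p V κ) := by
  have mem : ∀ V : X → Y → ℝ, (∀ x, V x ∈ stdSimplex ℝ Y) →
      (fun q : X × Y => p q.1 * V q.1 q.2) ∈ stdSimplex ℝ (X × Y) := by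
    intro V hV
    refine ⟨fun q => mul_nonneg (hp.1 _) ((hV _).1 _), ?_⟩
    rw [Fintype.sum_prod_type]
    simp only [← Finset.mul_sum, (hV _).2, mul_one, hp.2]
  have := sum_max_sub_le_sqrt (mem V hV) (mem κ hκ) (by
    rintro ⟨x, y⟩ h
    rcases mul_eq_zero.1 h with h | h
    · simp only [h, zero_mul]
    · simp only [hVκ _ _ h, mul_zero])
  rw [Fintype.sum_prod_type, Fintype.sum_prod_type] at this
  refine this.trans (le_of_eq ?_)
  congr 1
  refine Finset.sum_congr rfl fun x _ => ?_
  rw [Finset.mul_sum]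
  refine Finset.sum_congr rfl fun y _ => ?_
  by_cases h : p x = 0
  · simp [h]
  · simp only [mul_div_mul_left _ _ h]; ring

/-- Passing from `(x, y)` to `(y, z)` through the channel `w` cannot increase variational distance.
-/
theorem sum_max_jointYZ_sub_le (hμ : ∀ x z, μ (x, z) = p x * w x z) (hp : p ∈ stdSimplex ℝ X)
    (hw : ∀ x, w x ∈ stdSimplex ℝ Z) (hV : ∀ x, V x ∈ stdSimplex ℝ Y)
    (hκ : ∀ x, κ x ∈ stdSimplex ℝ Y) (hVκ : ∀ x y, κ x y = 0 → V x y = 0) :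
    ∑ q, max (jointYZ μ V q - jointYZ μ κ q) 0 ≤ √(condDiv p V κ) := by
  refine le_trans ?_ (sum_max_mul_sub_le hp hV hκ hVκ)
  have h1 : ∀ q : Y × Z, max (jointYZ μ V q - jointYZ μ κ q) 0 ≤
      ∑ x, w x q.2 * max (p x * V x q.1 - p x * κ x q.1) 0 := by
    intro q
    refine max_le ?_ (Finset.sum_nonneg fun x _ => mul_nonneg ((hw x).1 _) (le_max_right _ _))
    simp only [jointYZ, joint, ← Finset.sum_sub_distrib, hμ]
    refine Finset.sum_le_sum fun x _ => ?_
    calc _ = w x q.2 * (p x * V x q.1 - p x * κ x q.1) := by ring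
      _ ≤ _ := mul_le_mul_of_nonneg_left (le_max_left _ _) ((hw x).1 _)
  refine (Finset.sum_le_sum fun q _ => h1 q).trans (le_of_eq ?_)
  rw [Finset.sum_comm]
  refine Finset.sum_congr rfl fun x _ => ?_
  rw [Fintype.sum_prod_type]
  simp only [← Finset.sum_mul, (hw x).2, one_mul]

theorem expDistortion_le_add (hμ : ∀ x z, μ (x, z) = p x * w x z) (hp : p ∈ stdSimplex ℝ X)
    (hw : ∀ x, w x ∈ stdSimplex ℝ Z) (hV : ∀ x, V x ∈ stdSimplex ℝ Y)
    (hκ : ∀ x, κ x ∈ stdSimplex ℝ Y) (hVκ : ∀ x y, κ x y = 0 → V x y = 0)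
    {ρ : X → W → ℝ} {R : ℝ} (hρ : ∀ x w, 0 ≤ ρ x w) (hR : ∀ x w, ρ x w ≤ R) (hR0 : 0 ≤ R)
    (f : Y → Z → W) :
    expDistortion μ V ρ f ≤ expDistortion μ κ ρ f + R * √(condDiv p V κ) := by
  have h1 := mul_le_mul_of_nonneg_left (sum_max_mul_sub_le hp hV hκ hVκ) hR0
  suffices expDistortion μ V ρ f - expDistortion μ κ ρ f ≤
      R * ∑ x, ∑ y, max (p x * V x y - p x * κ x y) 0 by linarith
  simp only [expDistortion, joint, ← Finset.sum_sub_distrib, hμ, Finset.mul_sum]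
  refine Finset.sum_le_sum fun x _ => Finset.sum_le_sum fun y _ => ?_
  calc _ ≤ ∑ z, w x z * (R * max (p x * V x y - p x * κ x y) 0) := by
        refine Finset.sum_le_sum fun z _ => ?_
        calc _ = w x z * (ρ x (f y z) * (p x * V x y - p x * κ x y)) := by ring
          _ ≤ w x z * (ρ x (f y z) * max (p x * V x y - p x * κ x y) 0) :=
              mul_le_mul_of_nonneg_left
                (mul_le_mul_of_nonneg_left (le_max_left _ _) (hρ _ _)) ((hw x).1 z)
          _ ≤ _ := mul_le_mul_of_nonneg_left
                (mul_le_mul_of_nonneg_right (hR _ _) (le_max_right _ _)) ((hw x).1 z)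
    _ = _ := by rw [← Finset.sum_mul, (hw x).2, one_mul]

theorem jointYZ_eq_zero (hμ0 : ∀ q, 0 ≤ μ q) (hκ : ∀ x, κ x ∈ stdSimplex ℝ Y)
    (hVκ : ∀ x y, κ x y = 0 → V x y = 0) {q : Y × Z}
    (h : jointYZ μ κ q = 0) : jointYZ μ V q = 0 := by
  have := (Finset.sum_eq_zero_iff_of_nonneg
    fun x _ => mul_nonneg (hμ0 (x, q.2)) ((hκ x).1 q.1)).1 h
  refine Finset.sum_eq_zero fun x hx => ?_
  rcases mul_eq_zero.1 (this x hx) with h | h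
  · simp only [joint, h, zero_mul]
  · simp only [joint, hVκ _ _ h, mul_zero]

/-- Data processing: the log-sum inequality over `x` for each `(y, z)`, where `μ (x, z)` cancels in
the ratio. -/
theorem sum_jointYZ_mul_log_div_le (hμ : ∀ x z, μ (x, z) = p x * w x z) (hp : p ∈ stdSimplex ℝ X)
    (hw : ∀ x, w x ∈ stdSimplex ℝ Z) (hV : ∀ x, V x ∈ stdSimplex ℝ Y)
    (hκ : ∀ x, κ x ∈ stdSimplex ℝ Y) (hVκ : ∀ x y, κ x y = 0 → V x y = 0) :
    ∑ q, jointYZ μ V q * Real.log (jointYZ μ V q / jointYZ μ κ q) ≤ condDiv p V κ := by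
  have hμ0 : ∀ x z, 0 ≤ μ (x, z) := fun x z => hμ x z ▸ mul_nonneg (hp.1 x) ((hw x).1 z)
  have h1 : ∀ q : Y × Z, jointYZ μ V q * Real.log (jointYZ μ V q / jointYZ μ κ q) ≤
      ∑ x, w x q.2 * (p x * (V x q.1 * Real.log (V x q.1 / κ x q.1))) := by
    intro q
    have := sum_mul_log_sum_div_sum_le (P := fun x => joint μ V x q.1 q.2)
      (Q := fun x => joint μ κ x q.1 q.2) (fun x => mul_nonneg (hμ0 _ _) ((hV x).1 _))
      (fun x => mul_nonneg (hμ0 _ _) ((hκ x).1 _)) (fun x h => by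
        rcases mul_eq_zero.1 h with h | h
        · simp only [joint, h, zero_mul]
        · simp only [joint, hVκ _ _ h, mul_zero])
    refine this.trans (le_of_eq (Finset.sum_congr rfl fun x _ => ?_))
    simp only [joint]
    by_cases h : μ (x, q.2) = 0
    · have h' := h
      rw [hμ] at h'
      rw [h]
      linear_combination -(V x q.1 * Real.log (V x q.1 / κ x q.1)) * h'
    · rw [mul_div_mul_left _ _ h, hμ]; ring
  refine (Finset.sum_le_sum fun q _ => h1 q).trans (le_of_eq ?_)
  rw [Finset.sum_comm]
  refine Finset.sum_congr rfl fun x _ => ?_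
  rw [Fintype.sum_prod_type]
  simp only [← Finset.sum_mul, (hw x).2, one_mul, Finset.mul_sum]

/-- The cost of describing `y` given `z` with the model `κ` when the true channel is `V`. It exceeds
`H(Y|Z)` by a divergence, handled by data processing, and an entropy difference, handled by
continuity. -/
theorem sum_jointYZ_mul_neg_log_condDist_le [Nonempty Y] [Nonempty Z]
    (hμ : ∀ x z, μ (x, z) = p x * w x z)
    (hμs : μ ∈ stdSimplex ℝ (X × Z)) (hp : p ∈ stdSimplex ℝ X)
    (hw : ∀ x, w x ∈ stdSimplex ℝ Z) (hV : ∀ x, V x ∈ stdSimplex ℝ Y)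
    (hκ : ∀ x, κ x ∈ stdSimplex ℝ Y) (hVκ : ∀ x y, κ x y = 0 → V x y = 0) {s : ℝ} (hs : 0 < s) :
    ∑ z, ∑ y, jointYZ μ V (y, z) * -Real.log (condDist (jointYZ μ κ) z y) ≤
      condEntropy (jointYZ μ κ) * Real.log 2 + condDiv p V κ +
        √(condDiv p V κ) * max (Real.log (Fintype.card (Y × Z) / s)) 0 + s := by
  have mV := jointYZ_mem_stdSimplex hμs hV
  have mκ := jointYZ_mem_stdSimplex hμs hκ
  have h1 := sum_jointYZ_mul_log_div_le hμ hp hw hV hκ hVκ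
  have h2 := sum_negMulLog_sub_le mV mκ hs
  have h3 : (∑ q, max (jointYZ μ V q - jointYZ μ κ q) 0) *
      Real.log (Fintype.card (Y × Z) / s) ≤
        √(condDiv p V κ) * max (Real.log (Fintype.card (Y × Z) / s)) 0 :=
    (mul_le_mul_of_nonneg_left (le_max_left _ _)
      (Finset.sum_nonneg fun q _ => le_max_right _ _)).trans
      (mul_le_mul_of_nonneg_right (sum_max_jointYZ_sub_le hμ hp hw hV hκ hVκ) (le_max_right _ _))
  -- Cross entropy is `-H(Z) + H(YZ) + divergence`. The law of `Z` does not depend on the channel,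
  -- so `H(Z)` drops out on comparing `U = V` with `U = κ`.
  have key : ∀ U : X → Y → ℝ, (∀ x, U x ∈ stdSimplex ℝ Y) → (∀ x y, κ x y = 0 → U x y = 0) →
      ∑ z, ∑ y, jointYZ μ U (y, z) * -Real.log (condDist (jointYZ μ κ) z y) =
        ∑ z, (∑ x, μ (x, z)) * Real.log (∑ x, μ (x, z)) + ∑ q, Real.negMulLog (jointYZ μ U q) +
          ∑ q, jointYZ μ U q * Real.log (jointYZ μ U q / jointYZ μ κ q) := by
    intro U hU hUκ
    have mU := jointYZ_mem_stdSimplex hμs hU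
    rw [Fintype.sum_prod_type_right, Fintype.sum_prod_type_right, ← Finset.sum_add_distrib,
      ← Finset.sum_add_distrib]
    refine Finset.sum_congr rfl fun z _ => ?_
    conv_rhs => enter [1, 1, 1]; rw [← margSnd_jointYZ μ hU z, margSnd]
    rw [Finset.sum_mul, ← Finset.sum_add_distrib, ← Finset.sum_add_distrib]
    refine Finset.sum_congr rfl fun y _ => ?_
    by_cases h0 : jointYZ μ U (y, z) = 0
    · simp [h0]
    have hκ0 : jointYZ μ κ (y, z) ≠ 0 := fun h => h0 (jointYZ_eq_zero hμs.1 hκ hUκ h)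
    have hr : ∑ x, μ (x, z) ≠ 0 := by
      rw [← margSnd_jointYZ μ hκ z]
      intro h
      exact hκ0 ((Finset.sum_eq_zero_iff_of_nonneg fun y _ => mκ.1 (y, z)).1 h y (Finset.mem_univ y))
    rw [condDist, margSnd_jointYZ μ hκ, Real.log_div hκ0 hr, Real.log_div h0 hκ0, Real.negMulLog]
    ring
  have e1 := key V hV hVκ
  have e2 := key κ hκ (fun _ _ h => h)
  rw [← condEntropy_mul_log_two mκ.1] at e2
  have e3 : ∑ q, jointYZ μ κ q * Real.log (jointYZ μ κ q / jointYZ μ κ q) = 0 := by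
    refine Finset.sum_eq_zero fun q _ => ?_
    by_cases h : jointYZ μ κ q = 0
    · simp [h]
    · simp [div_self h]
  linarith

end SingleLetter

/-! ### The numerical inequality behind the condition on `εA` and `εB`. -/

/-- Used with `r = √εA` and `K = |Y × Z|`: the right side is `2 ζ(3 εA) log 2`, the left side the
continuity loss with `s = r` plus one `e`. With `u = log (K / r)`, division by `r` leaves an
inequality linear in `r` and `u`. -/
theorem zeta_bound {K r : ℝ} (hK : 2 ≤ K) (hr : 0 < r) :
    r * max (Real.log (K / r)) 0 + r + r ^ 2 * Real.log 2 ≤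
      2 * ((3 * r ^ 2 - √(2 * (3 * r ^ 2)) * Real.logb 2 (√(2 * (3 * r ^ 2)) / K)) * Real.log 2) := by
  have hL := Real.log_two_gt_d9
  have hL' := Real.log_two_lt_d9
  have hL0 : Real.log 2 ≠ 0 := by positivity
  have h6 : √6 < 2.4495 := by
    rw [Real.sqrt_lt' (by norm_num)]; norm_num
  have h6' : 2.4494 < √6 := by
    rw [Real.lt_sqrt (by norm_num)]; norm_num
  have hl6 : Real.log 6 ≤ 1.83 := by
    have h1 : Real.log 6 = 3 * Real.log 2 + Real.log (3 / 4) := by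
      rw [← Real.log_rpow (by norm_num), ← Real.log_mul (by norm_num) (by norm_num)]; norm_num
    have := Real.log_le_sub_one_of_pos (show (0 : ℝ) < 3 / 4 by norm_num)
    linarith
  have e1 : √(2 * (3 * r ^ 2)) = √6 * r := by
    rw [show 2 * (3 * r ^ 2) = 6 * r ^ 2 by ring, Real.sqrt_mul (by norm_num),
      Real.sqrt_sq hr.le]
  set u := Real.log (K / r) with hu
  have e2 : Real.log (√6 * r / K) = Real.log 6 / 2 - u := by
    rw [hu, Real.log_div (by positivity) (by positivity), Real.log_div (by positivity) hr.ne',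
      Real.log_mul (by positivity) hr.ne', Real.log_sqrt (by norm_num)]
    ring
  have e3 : r = K * Real.exp (-u) := by
    rw [Real.exp_neg, hu, Real.exp_log (by positivity)]
    field_simp
  rw [e1, Real.logb, e2]
  have e4 : 2 * ((3 * r ^ 2 - √6 * r * ((Real.log 6 / 2 - u) / Real.log 2)) * Real.log 2) =
      r * (6 * r * Real.log 2 - √6 * Real.log 6 + 2 * √6 * u) := by
    field_simp; ring
  rw [e4]
  have hlog6 : 0 ≤ Real.log 6 := Real.log_nonneg (by norm_num)
  have hb : √6 * Real.log 6 ≤ 4.49 := by nlinarith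
  have hmain : max u 0 + 1 + √6 * Real.log 6 ≤ 5 * r * Real.log 2 + 2 * √6 * u := by
    rcases le_total 0 u with h | h
    · rw [max_eq_left h]
      -- The tangent to `2 exp (-u)` at `u = log 2`; since `K ≥ 2`, also `r ≥ 2 exp (-u)`.
      have h1 : (1 + Real.log 2 - u) ≤ 2 * Real.exp (-u) := by
        have := Real.add_one_le_exp (Real.log 2 - u)
        rw [sub_eq_add_neg, Real.exp_add, Real.exp_log (by norm_num)] at this
        linarith
      have h2 : 1 + Real.log 2 - u ≤ r := by
        have := Real.exp_pos (-u)
        nlinarith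
      nlinarith
    · rw [max_eq_right h]
      have h1 := Real.add_one_le_exp (-u)
      have h2 : 2 * (1 - u) ≤ r := by
        have := Real.exp_pos (-u)
        nlinarith
      nlinarith
  nlinarith

/-! ### Letter counts, conditional types and the method of types. -/

section Counts

open Classical in
/-- The number of occurrences of `a` in the sequence `s`. -/
noncomputable def cnt {U : Type*} {n : ℕ} (s : Fin n → U) (a : U) : ℝ :=
  ∑ i, if s i = a then 1 else 0

variable {U : Type*} {n : ℕ}

theorem cnt_nonneg (s : Fin n → U) (a : U) : 0 ≤ cnt s a :=
  Finset.sum_nonneg fun i _ => by split_ifs <;> norm_num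

theorem cnt_pos (s : Fin n → U) (i : Fin n) : 0 < cnt s (s i) :=
  Finset.sum_pos' (fun i _ => by split_ifs <;> norm_num) ⟨i, Finset.mem_univ _, by simp⟩

theorem exists_of_cnt_ne_zero {s : Fin n → U} {a : U} (h : cnt s a ≠ 0) : ∃ i, s i = a := by
  by_contra hc
  push Not at hc
  exact h (Finset.sum_eq_zero fun i _ => if_neg (hc i))

theorem sum_comp_eq_sum_cnt [Fintype U] (s : Fin n → U) (g : U → ℝ) :
    ∑ i, g (s i) = ∑ a, cnt s a * g a := by
  simp only [cnt, Finset.sum_mul]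
  rw [Finset.sum_comm]
  refine Finset.sum_congr rfl fun i _ => ?_
  rw [Finset.sum_eq_single (s i)]
  · simp
  · intro a _ ha
    simp [ha.symm]
  · simp

/-- Each count has only `n + 1` possible values, which makes the number of types polynomial in `n`.
-/
theorem cnt_eq_natCast (s : Fin n → U) (a : U) : ∃ k : Fin (n + 1), cnt s a = (k : ℕ) := by
  classical
  refine ⟨⟨(Finset.univ.filter fun i => s i = a).card,
    Nat.lt_succ_of_le ((Finset.card_le_univ _).trans (by simp))⟩, ?_⟩
  rw [cnt, Finset.sum_boole]

end Counts

theorem sum_biUnion_le_sum {ι U : Type*} [DecidableEq U] (s : Finset ι) (E : ι → Finset U)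
    {F : U → ℝ} (hF : ∀ u, 0 ≤ F u) : ∑ u ∈ s.biUnion E, F u ≤ ∑ a ∈ s, ∑ u ∈ E a, F u := by
  classical
  induction s using Finset.induction_on with
  | empty => simp
  | insert a s ha ih =>
    rw [Finset.biUnion_insert, Finset.sum_insert ha]
    have := Finset.sum_union_inter (s₁ := E a) (s₂ := s.biUnion E) (f := F)
    have h0 : 0 ≤ ∑ u ∈ E a ∩ s.biUnion E, F u := Finset.sum_nonneg fun u _ => hF u
    linarith

section EmpCond

variable {X Y Z : Type*} [Fintype X] [Fintype Y] [Fintype Z] {n : ℕ}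

open Classical in
/-- The conditional distribution of `y` given `x` under the joint type of `(x, y)`, completed by
`κ` for the letters that do not occur in `x`. -/
noncomputable def empCond (κ : X → Y → ℝ) (x : Fin n → X) (y : Fin n → Y) (a : X) (b : Y) : ℝ :=
  if cnt x a = 0 then κ a b else cnt (fun i => (x i, y i)) (a, b) / cnt x a

theorem sum_cnt_pair (x : Fin n → X) (y : Fin n → Y) (a : X) :
    ∑ b, cnt (fun i => (x i, y i)) (a, b) = cnt x a := by
  classical
  simp only [cnt, Prod.mk.injEq]
  rw [Finset.sum_comm]
  refine Finset.sum_congr rfl fun i _ => ?_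
  by_cases h : x i = a
  · simp [h]
  · simp [h]

theorem cnt_mul_empCond (κ : X → Y → ℝ) (x : Fin n → X) (y : Fin n → Y) (a : X) (b : Y) :
    cnt x a * empCond κ x y a b = cnt (fun i => (x i, y i)) (a, b) := by
  unfold empCond
  split_ifs with h
  · rw [h, zero_mul]
    have := sum_cnt_pair x y a
    rw [h] at this
    exact ((Finset.sum_eq_zero_iff_of_nonneg fun b _ => cnt_nonneg _ _).1 this b
      (Finset.mem_univ b)).symm
  · rw [mul_div_cancel₀ _ h]

theorem empCond_mem_stdSimplex {κ : X → Y → ℝ} (hκ : ∀ x, κ x ∈ stdSimplex ℝ Y) (x : Fin n → X)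
    (y : Fin n → Y) (a : X) : empCond κ x y a ∈ stdSimplex ℝ Y := by
  by_cases h : cnt x a = 0
  · have : empCond κ x y a = κ a := by
      funext b; simp [empCond, h]
    rw [this]; exact hκ a
  · have : empCond κ x y a = fun b => cnt (fun i => (x i, y i)) (a, b) / cnt x a := by
      funext b; simp [empCond, h]
    rw [this]
    refine ⟨fun b => div_nonneg (cnt_nonneg _ _) (cnt_nonneg _ _), ?_⟩
    rw [← Finset.sum_div, sum_cnt_pair, div_self h]

/-- Absolute continuity with respect to `κ`; it holds also at letters absent from `x` thanks to the
completion by `κ`. -/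
theorem empCond_eq_zero {κ : X → Y → ℝ} {x : Fin n → X} {y : Fin n → Y}
    (h : ∀ i, κ (x i) (y i) ≠ 0) (a : X) (b : Y) (hab : κ a b = 0) : empCond κ x y a b = 0 := by
  unfold empCond
  split_ifs with h0
  · exact hab
  · by_cases h1 : cnt (fun i => (x i, y i)) (a, b) = 0
    · rw [h1, zero_div]
    · obtain ⟨i, hi⟩ := exists_of_cnt_ne_zero h1
      rw [Prod.mk.injEq] at hi
      exact absurd (by rw [hi.1, hi.2]; exact hab) (h i)

theorem sum_eq_sum_empCond (κ : X → Y → ℝ) (x : Fin n → X) (y : Fin n → Y) (g : X → Y → ℝ) :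
    ∑ i, g (x i) (y i) = ∑ i, ∑ b, empCond κ x y (x i) b * g (x i) b := by
  rw [sum_comp_eq_sum_cnt x (fun a => ∑ b, empCond κ x y a b * g a b),
    sum_comp_eq_sum_cnt (fun i => (x i, y i)) (fun q => g q.1 q.2), Fintype.sum_prod_type]
  refine Finset.sum_congr rfl fun a _ => ?_
  rw [Finset.mul_sum]
  refine Finset.sum_congr rfl fun b _ => ?_
  rw [← mul_assoc, cnt_mul_empCond]

theorem empCond_pos (κ : X → Y → ℝ) (x : Fin n → X) (y : Fin n → Y) (i : Fin n) :
    0 < empCond κ x y (x i) (y i) := by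
  have h := cnt_pos x i
  rw [empCond, if_neg h.ne']
  exact div_pos (cnt_pos (fun i => (x i, y i)) i) h

/-- The conditional entropy (in nats) of the joint type, times the length. -/
noncomputable def empEntropy (κ : X → Y → ℝ) (x : Fin n → X) (y : Fin n → Y) : ℝ :=
  ∑ i, ∑ b, Real.negMulLog (empCond κ x y (x i) b)

theorem prod_empCond (κ : X → Y → ℝ) (x : Fin n → X) (y : Fin n → Y) :
    ∏ i, empCond κ x y (x i) (y i) = Real.exp (-empEntropy κ x y) := by
  have h1 : ∏ i, empCond κ x y (x i) (y i) =
      Real.exp (∑ i, Real.log (empCond κ x y (x i) (y i))) := by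
    rw [Real.exp_sum]
    exact Finset.prod_congr rfl fun i _ => (Real.exp_log (empCond_pos κ x y i)).symm
  rw [h1, sum_eq_sum_empCond κ x y (fun a b => Real.log (empCond κ x y a b)), empEntropy]
  congr 1
  simp only [Real.negMulLog, neg_mul, Finset.sum_neg_distrib, neg_neg]

-- Under the product of its own conditional type, a sequence has probability `exp (-empEntropy)`, at
-- least `exp (-h)` here. Hence each type class has at most `exp h` elements, and there are at most
-- `(n + 1) ^ (|X| |Y|)` classes.
open Classical in
theorem card_empEntropy_le {κ : X → Y → ℝ} (hκ : ∀ x, κ x ∈ stdSimplex ℝ Y) (x : Fin n → X)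
    (h : ℝ) :
    ((Finset.univ.filter fun y : Fin n → Y => empEntropy κ x y ≤ h).card : ℝ) ≤
      ((n : ℝ) + 1) ^ (Fintype.card X * Fintype.card Y) * Real.exp h := by
  choose k hk using fun (y : Fin n → Y) (q : X × Y) => cnt_eq_natCast (fun i => (x i, y i)) q
  set S := Finset.univ.filter fun y : Fin n → Y => empEntropy κ x y ≤ h with hS
  have hcong : ∀ y y', k y = k y' → empCond κ x y = empCond κ x y' := by
    intro y y' e
    funext a b
    simp only [empCond, hk, e]
  have hfib : ∀ τ ∈ S.image k, ((S.filter fun y => k y = τ).card : ℝ) ≤ Real.exp h := by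
    intro τ hτ
    obtain ⟨y0, -, rfl⟩ := Finset.mem_image.1 hτ
    have h1 : ((S.filter fun y => k y = k y0).card : ℝ) * Real.exp (-h) ≤
        ∑ y : Fin n → Y, ∏ i, empCond κ x y0 (x i) (y i) := by
      refine le_trans ?_ (Finset.sum_le_univ_sum_of_nonneg (s := S.filter fun y => k y = k y0)
        fun y => Finset.prod_nonneg fun i _ => (empCond_mem_stdSimplex hκ x y0 (x i)).1 _)
      rw [← nsmul_eq_mul]
      refine Finset.card_nsmul_le_sum _ _ _ fun y hy => ?_
      rw [Finset.mem_filter, hS, Finset.mem_filter] at hy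
      rw [← hcong y y0 hy.2, prod_empCond]
      exact Real.exp_le_exp.2 (neg_le_neg hy.1.2)
    rw [sum_prod_eq_one (fun i => empCond κ x y0 (x i))
      (fun i => (empCond_mem_stdSimplex hκ x y0 (x i)).2), Real.exp_neg,
      ← div_eq_mul_inv, div_le_one (Real.exp_pos h)] at h1
    exact h1
  rw [Finset.card_eq_sum_card_image k S]
  push_cast
  refine (Finset.sum_le_sum hfib).trans ?_
  rw [Finset.sum_const, nsmul_eq_mul]
  refine mul_le_mul_of_nonneg_right ?_ (Real.exp_pos h).le
  have h2 : (S.image k).card ≤ (n + 1) ^ (Fintype.card X * Fintype.card Y) := by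
    refine (Finset.card_le_univ _).trans (le_of_eq ?_)
    simp
  exact_mod_cast h2

/-! ### Typical sequences. -/

/-- The letter-wise typicality of `x`. -/
def TypX (p : X → ℝ) (t : ℝ) (x : Fin n → X) : Prop := ∀ a, |cnt x a - n * p a| < t * n

open Classical in
/-- The letter-wise conditional typicality of `z` given `(x, y)`. -/
def TypZ (w : X → Z → ℝ) (t : ℝ) (x : Fin n → X) (y : Fin n → Y) (z : Fin n → Z) : Prop :=
  ∀ a b d, |∑ i, (if x i = a ∧ y i = b ∧ z i = d then (1 : ℝ) else 0) -
    ∑ i, (if x i = a ∧ y i = b then w a d else 0)| < t * n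

variable {p : X → ℝ} {w : X → Z → ℝ} {κ : X → Y → ℝ} {t : ℝ}

open Classical in
theorem sum_not_typX_le (hn : 0 < n) (hp : p ∈ stdSimplex ℝ X) (ht : 0 < t) :
    ∑ x : Fin n → X with ¬ TypX p t x, ∏ i, p (x i) ≤ Fintype.card X / (n * t ^ 2) := by
  have hpos : ∀ x : Fin n → X, 0 ≤ ∏ i, p (x i) := fun x => Finset.prod_nonneg fun i _ => hp.1 _
  have h1 : (Finset.univ.filter fun x : Fin n → X => ¬ TypX p t x) ⊆
      Finset.univ.biUnion fun a => Finset.univ.filter fun x : Fin n → X =>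
        t * n ≤ |cnt x a - n * p a| := by
    intro x hx
    simpa [TypX] using hx
  refine (Finset.sum_le_sum_of_subset_of_nonneg h1 fun x _ _ => hpos x).trans ?_
  refine (sum_biUnion_le_sum _ _ hpos).trans ?_
  have h2 : ∀ a, ∑ x : Fin n → X with t * n ≤ |cnt x a - n * p a|, ∏ i, p (x i) ≤
      1 / (n * t ^ 2) := by
    intro a
    have := chebyshev_prod hn (fun _ => p) (fun (_ : Fin n) (b : X) => if b = a then (1 : ℝ) else 0)
      (fun _ => hp) (G := 1) (fun i b => by split_ifs <;> simp) ht
      (Finset.univ.filter fun x : Fin n → X => t * n ≤ |cnt x a - n * p a|) (by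
        intro x hx
        rw [Finset.mem_filter] at hx
        simpa [cnt] using hx.2)
    simpa using this
  refine (Finset.sum_le_sum fun a _ => h2 a).trans (le_of_eq ?_)
  rw [Finset.sum_const, nsmul_eq_mul, Finset.card_univ]; ring

open Classical in
theorem sum_not_typZ_le (hn : 0 < n) (hw : ∀ x, w x ∈ stdSimplex ℝ Z) (ht : 0 < t)
    (x : Fin n → X) (y : Fin n → Y) :
    ∑ z : Fin n → Z with ¬ TypZ w t x y z, ∏ i, w (x i) (z i) ≤
      Fintype.card (X × Y × Z) / (n * t ^ 2) := by
  have hpos : ∀ z : Fin n → Z, 0 ≤ ∏ i, w (x i) (z i) :=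
    fun z => Finset.prod_nonneg fun i _ => (hw _).1 _
  set E : X × Y × Z → Finset (Fin n → Z) := fun q => Finset.univ.filter fun z : Fin n → Z =>
    t * n ≤ |∑ i, (if x i = q.1 ∧ y i = q.2.1 ∧ z i = q.2.2 then (1 : ℝ) else 0) -
      ∑ i, (if x i = q.1 ∧ y i = q.2.1 then w q.1 q.2.2 else 0)| with hE
  have h1 : (Finset.univ.filter fun z : Fin n → Z => ¬ TypZ w t x y z) ⊆
      Finset.univ.biUnion E := by
    intro z hz
    simpa [TypZ, hE] using hz
  refine (Finset.sum_le_sum_of_subset_of_nonneg h1 fun x _ _ => hpos x).trans ?_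
  refine (sum_biUnion_le_sum _ _ hpos).trans ?_
  have h2 : ∀ q, ∑ z ∈ E q, ∏ i, w (x i) (z i) ≤ 1 / (n * t ^ 2) := by
    rintro ⟨a, b, d⟩
    have := chebyshev_prod hn (fun i => w (x i))
      (fun i (d' : Z) => if x i = a ∧ y i = b ∧ d' = d then (1 : ℝ) else 0)
      (fun i => hw _) (G := 1) (fun i b => by split_ifs <;> simp) ht (E (a, b, d)) (by
        intro z hz
        rw [hE, Finset.mem_filter] at hz
        convert hz.2 using 5 with i
        by_cases h : x i = a ∧ y i = b
        · simp [h.1, h.2]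
        · have : ∀ d', ¬ (x i = a ∧ y i = b ∧ d' = d) := fun d' h' => h ⟨h'.1, h'.2.1⟩
          simp [h, this])
    simpa using this
  refine (Finset.sum_le_sum fun a _ => h2 a).trans (le_of_eq ?_)
  rw [Finset.sum_const, nsmul_eq_mul, Finset.card_univ]; ring

theorem TypX.abs_sum_sub_le {x : Fin n → X} (hx : TypX p t x) {g : X → ℝ} {G : ℝ}
    (hG : ∀ a, |g a| ≤ G) :
    |∑ i, g (x i) - n * ∑ a, p a * g a| ≤ Fintype.card X * (t * n * G) := by
  rw [sum_comp_eq_sum_cnt, Finset.mul_sum, ← Finset.sum_sub_distrib]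
  refine (Finset.abs_sum_le_sum_abs _ _).trans ?_
  rw [← nsmul_eq_mul, ← Finset.card_univ]
  refine Finset.sum_le_card_nsmul _ _ _ fun a _ => ?_
  rw [← mul_assoc, ← sub_mul, abs_mul]
  exact mul_le_mul (hx a).le (hG a) (abs_nonneg _) ((abs_nonneg _).trans (hx a).le)

theorem TypZ.abs_sum_sub_le {x : Fin n → X} {y : Fin n → Y} {z : Fin n → Z}
    (hz : TypZ w t x y z) {g : X → Y → Z → ℝ} {G : ℝ} (hG : ∀ a b d, |g a b d| ≤ G) :
    |∑ i, g (x i) (y i) (z i) - ∑ i, ∑ d, w (x i) d * g (x i) (y i) d| ≤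
      Fintype.card (X × Y × Z) * (t * n * G) := by
  classical
  have e1 : ∑ i, g (x i) (y i) (z i) = ∑ q : X × Y × Z, g q.1 q.2.1 q.2.2 *
      ∑ i, (if x i = q.1 ∧ y i = q.2.1 ∧ z i = q.2.2 then (1 : ℝ) else 0) := by
    simp only [Finset.mul_sum]
    rw [Finset.sum_comm]
    refine Finset.sum_congr rfl fun i _ => ?_
    rw [Finset.sum_eq_single (x i, y i, z i)]
    · simp
    · rintro ⟨a, b, d⟩ - hq
      rw [if_neg, mul_zero]
      rintro ⟨rfl, rfl, rfl⟩
      exact hq rfl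
    · simp
  have e2 : ∑ i, ∑ d, w (x i) d * g (x i) (y i) d = ∑ q : X × Y × Z, g q.1 q.2.1 q.2.2 *
      ∑ i, (if x i = q.1 ∧ y i = q.2.1 then w q.1 q.2.2 else 0) := by
    simp only [Finset.mul_sum]
    conv_rhs => rw [Finset.sum_comm]
    refine Finset.sum_congr rfl fun i _ => ?_
    rw [Fintype.sum_prod_type, Finset.sum_eq_single (x i), Fintype.sum_prod_type,
      Finset.sum_eq_single (y i)]
    · simp [mul_comm]
    · intro b _ hb
      simp [Ne.symm hb]
    · simp
    · intro a _ ha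
      simp [Ne.symm ha]
    · simp
  rw [e1, e2, ← Finset.sum_sub_distrib]
  refine (Finset.abs_sum_le_sum_abs _ _).trans ?_
  rw [← nsmul_eq_mul, ← Finset.card_univ]
  refine Finset.sum_le_card_nsmul Finset.univ _ _ fun (q : X × Y × Z) _ => ?_
  rw [← mul_sub, abs_mul, mul_comm]
  have := (hz q.1 q.2.1 q.2.2).le
  exact mul_le_mul this (hG _ _ _) (abs_nonneg _) ((abs_nonneg _).trans this)

theorem abs_sum_mul_le {U : Type*} [Fintype U] {P g : U → ℝ} (hP : P ∈ stdSimplex ℝ U) {G : ℝ}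
    (hG : ∀ u, |g u| ≤ G) : |∑ u, P u * g u| ≤ G := by
  refine (Finset.abs_sum_le_sum_abs _ _).trans ?_
  calc _ ≤ ∑ u, P u * G := Finset.sum_le_sum fun u _ => by
        rw [abs_mul, abs_of_nonneg (hP.1 u)]
        exact mul_le_mul_of_nonneg_left (hG u) (hP.1 u)
    _ = G := by rw [← Finset.sum_mul, hP.2, one_mul]

/-- Averages over jointly typical sequences are approximated by expectations with respect to the
empirical conditional distribution of `y` given `x`. -/
theorem abs_sum_sub_sum_empCond_le (hw : ∀ x, w x ∈ stdSimplex ℝ Z)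
    (hκ : ∀ x, κ x ∈ stdSimplex ℝ Y) {x : Fin n → X} {y : Fin n → Y} {z : Fin n → Z}
    (hx : TypX p t x) (hz : TypZ w t x y z) {g : X → Y → Z → ℝ} {G : ℝ}
    (hG : ∀ a b d, |g a b d| ≤ G) :
    |∑ i, g (x i) (y i) (z i) -
      n * ∑ a, p a * ∑ b, empCond κ x y a b * ∑ d, w a d * g a b d| ≤
      (Fintype.card (X × Y × Z) + Fintype.card X) * (t * n * G) := by
  have h1 := hz.abs_sum_sub_le hG
  have h2 := hx.abs_sum_sub_le (g := fun a => ∑ b, empCond κ x y a b * ∑ d, w a d * g a b d)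
    (G := G) (fun a => abs_sum_mul_le (empCond_mem_stdSimplex hκ x y a)
      fun b => abs_sum_mul_le (hw a) (hG a b))
  rw [← sum_eq_sum_empCond κ x y (fun a b => ∑ d, w a d * g a b d)] at h2
  have := abs_sub_le (∑ i, g (x i) (y i) (z i)) (∑ i, ∑ d, w (x i) d * g (x i) (y i) d)
    (n * ∑ a, p a * ∑ b, empCond κ x y a b * ∑ d, w a d * g a b d)
  linarith

theorem sum_mul_log_div_nonneg {U : Type*} [Fintype U] {P Q : U → ℝ} (hP : P ∈ stdSimplex ℝ U)
    (hQ : Q ∈ stdSimplex ℝ U) (hPQ : ∀ u, Q u = 0 → P u = 0) :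
    0 ≤ ∑ u, P u * Real.log (P u / Q u) := by
  have := sum_mul_log_sum_div_sum_le hP.1 hQ.1 hPQ
  rwa [hP.2, hQ.2, div_one, Real.log_one, mul_zero] at this

theorem sum_mul_log_div_eq {U : Type*} [Fintype U] {P Q : U → ℝ}
    (hPQ : ∀ u, Q u = 0 → P u = 0) : ∑ u, P u * Real.log (P u / Q u) =
      ∑ u, P u * -Real.log (Q u) - ∑ u, Real.negMulLog (P u) := by
  rw [← Finset.sum_sub_distrib]
  refine Finset.sum_congr rfl fun u _ => ?_
  by_cases h : P u = 0
  · simp [h]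
  · rw [Real.log_div h fun h' => h (hPQ u h'), Real.negMulLog]; ring

/-- Averaged over the letters of `x`, the divergence is the normalized negative log-likelihood of
`y` minus the entropy of its conditional type. Typicality of `x` replaces that average by the one
under `p`. -/
theorem condDiv_empCond_le (hn : 0 < n) (hκ : ∀ x, κ x ∈ stdSimplex ℝ Y) {x : Fin n → X}
    {y : Fin n → Y} (hx : TypX p t x) (hy : ∀ i, κ (x i) (y i) ≠ 0) {M h₁ h₂ : ℝ}
    (hM : ∀ a b, |Real.log (κ a b)| ≤ M)
    (h1 : ∑ i, -Real.log (κ (x i) (y i)) ≤ n * h₁) (h2 : n * h₂ ≤ empEntropy κ x y) :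
    condDiv p (empCond κ x y) κ ≤ h₁ - h₂ + Fintype.card X * (t * M) := by
  have hn' : (0 : ℝ) < n := by exact_mod_cast hn
  have hac := empCond_eq_zero hy
  have hV := empCond_mem_stdSimplex hκ x y
  -- Each row divergence is nonnegative and equals a cross entropy, at most `M`, minus a nonnegative
  -- entropy.
  have h3 := hx.abs_sum_sub_le (G := M)
    (g := fun a => ∑ b, empCond κ x y a b * Real.log (empCond κ x y a b / κ a b)) (fun a => by
      rw [abs_of_nonneg (sum_mul_log_div_nonneg (hV a) (hκ a) (hac a)), sum_mul_log_div_eq (hac a)]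
      have e1 : 0 ≤ ∑ b, Real.negMulLog (empCond κ x y a b) :=
        Finset.sum_nonneg fun b _ => Real.negMulLog_nonneg ((hV a).1 b)
          ((Finset.single_le_sum (fun i _ => (hV a).1 i) (Finset.mem_univ b)).trans (hV a).2.le)
      have e2 := (le_abs_self _).trans
        (abs_sum_mul_le (g := fun b => -Real.log (κ a b)) (hV a) fun b => by
          rw [abs_neg]; exact hM a b)
      linarith)
  have h4 : ∑ i, ∑ b, empCond κ x y (x i) b * Real.log (empCond κ x y (x i) b / κ (x i) b) =
      ∑ i, -Real.log (κ (x i) (y i)) - empEntropy κ x y := by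
    rw [sum_eq_sum_empCond κ x y (fun a b => -Real.log (κ a b)), empEntropy,
      ← Finset.sum_sub_distrib]
    exact Finset.sum_congr rfl fun i _ => sum_mul_log_div_eq (hac _)
  rw [h4] at h3
  have h5 := (abs_le.1 h3).1
  rw [← condDiv] at h5
  have : n * condDiv p (empCond κ x y) κ ≤ n * (h₁ - h₂ + Fintype.card X * (t * M)) := by
    linarith
  exact le_of_mul_le_mul_left this hn'

open Classical in
/-- The set of the sequences `y` that are typical in the sense of entropy, given `x`. -/
noncomputable def entTyp (κ : X → Y → ℝ) (t : ℝ) (x : Fin n → X) : Finset (Fin n → Y) :=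
  Finset.univ.filter fun y => (∀ i, κ (x i) (y i) ≠ 0) ∧
    |∑ i, -Real.log (κ (x i) (y i)) - ∑ i, ∑ b, Real.negMulLog (κ (x i) b)| < t * n

theorem prod_eq_exp_of_ne_zero (hκ : ∀ x, κ x ∈ stdSimplex ℝ Y) {x : Fin n → X} {y : Fin n → Y}
    (hy : ∀ i, κ (x i) (y i) ≠ 0) :
    ∏ i, κ (x i) (y i) = Real.exp (-∑ i, -Real.log (κ (x i) (y i))) := by
  rw [← Finset.sum_neg_distrib, Real.exp_sum]
  refine Finset.prod_congr rfl fun i _ => ?_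
  rw [neg_neg, Real.exp_log (((hκ _).1 _).lt_of_ne (hy i).symm)]

/-- The set has conditional probability at least `1 / 2`, and none of its elements has probability
above `exp (-(h - t * n))`. -/
theorem le_card_entTyp (hn : 0 < n) (hκ : ∀ x, κ x ∈ stdSimplex ℝ Y) (x : Fin n → X) {M : ℝ}
    (hM : ∀ a b, |Real.log (κ a b)| ≤ M) (ht : 0 < t) (hnt : M ^ 2 / (n * t ^ 2) ≤ 1 / 2) :
    Real.exp (∑ i, ∑ b, Real.negMulLog (κ (x i) b) - t * n) / 2 ≤ (entTyp κ t x).card := by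
  classical
  set h := ∑ i, ∑ b, Real.negMulLog (κ (x i) b) with hh
  set S := Finset.univ.filter fun y : Fin n → Y =>
    t * n ≤ |∑ i, -Real.log (κ (x i) (y i)) - h| with hS
  have h1 := chebyshev_prod hn (fun i => κ (x i)) (fun i b => -Real.log (κ (x i) b))
    (fun i => hκ _) (G := M) (fun i b => by rw [abs_neg]; exact hM _ _) ht S (by
      intro y hy
      rw [hS, Finset.mem_filter] at hy
      convert hy.2 using 5
      simp [Real.negMulLog])
  have h2 := sum_prod_eq_one (fun i => κ (x i)) (fun i => (hκ _).2)
  rw [← Finset.sum_add_sum_compl S] at h2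
  have h3 : ∑ y ∈ Sᶜ, ∏ i, κ (x i) (y i) ≤ ∑ y ∈ entTyp κ t x, ∏ i, κ (x i) (y i) := by
    -- Sequences of probability zero are discarded first: with `log 0 = 0` their log-likelihood sum
    -- is meaningless, and `entTyp` excludes them.
    rw [← Finset.sum_filter_ne_zero]
    refine Finset.sum_le_sum_of_subset_of_nonneg ?_
      (fun y _ _ => Finset.prod_nonneg fun i _ => (hκ _).1 _)
    intro y hy
    simp only [hS, Finset.mem_filter, Finset.mem_compl, Finset.mem_univ, true_and, not_le] at hy
    simp only [entTyp, Finset.mem_filter, Finset.mem_univ, true_and]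
    exact ⟨fun i hi => hy.2 (Finset.prod_eq_zero (Finset.mem_univ i) hi), hy.1⟩
  have h4 : ∑ y ∈ entTyp κ t x, ∏ i, κ (x i) (y i) ≤
      (entTyp κ t x).card * Real.exp (-(h - t * n)) := by
    rw [← nsmul_eq_mul]
    refine Finset.sum_le_card_nsmul _ _ _ fun y hy => ?_
    simp only [entTyp, Finset.mem_filter, Finset.mem_univ, true_and] at hy
    rw [prod_eq_exp_of_ne_zero hκ hy.1]
    have := (abs_lt.1 hy.2).1
    exact Real.exp_le_exp.2 (by linarith)
  have h5 : 1 / 2 ≤ (entTyp κ t x).card * Real.exp (-(h - t * n)) := by linarith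
  rw [Real.exp_neg, ← div_eq_mul_inv, le_div_iff₀ (Real.exp_pos _)] at h5
  linarith

end EmpCond

/-! ### Saturation and collision resistance from the hash property. -/

namespace Ensemble

variable {U V : Type*} [Finite V]

/-- `Im 𝒜` as a finite set. -/
noncomputable def imFinset (E : Ensemble U V) : Finset V := (Set.toFinite E.im).toFinset

theorem mem_imFinset (E : Ensemble U V) {c : V} : c ∈ E.imFinset ↔ c ∈ E.im := by
  simp [imFinset]

theorem card_imFinset (E : Ensemble U V) : E.imFinset.card = E.im.ncard :=
  (Set.ncard_eq_toFinset_card _ _).symm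

theorem apply_mem_imFinset (E : Ensemble U V) {A : U → V} (hA : A ∈ E.carrier) (u : U) :
    A u ∈ E.imFinset := by
  rw [mem_imFinset, im]
  exact Set.mem_biUnion hA ⟨u, rfl⟩

theorem imFinset_card_pos [Nonempty U] (E : Ensemble U V) : 0 < E.imFinset.card := by
  have : E.carrier.Nonempty := by
    by_contra h
    have := E.prob_sum
    rw [Finset.not_nonempty_iff_eq_empty.1 h] at this
    simp at this
  obtain ⟨A, hA⟩ := this
  exact Finset.card_pos.2 ⟨_, E.apply_mem_imFinset hA (Classical.arbitrary U)⟩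

/-- The inequality of the hash property, for one ensemble. -/
def HashBound [DecidableEq U] (E : Ensemble U V) (α β : ℝ) : Prop :=
  ∀ T T' : Finset U, ∑ u ∈ T, ∑ u' ∈ T', E.collisionProb u u' ≤
      ((T ∩ T').card : ℝ) + (T.card : ℝ) * (T'.card : ℝ) * α / (E.im.ncard : ℝ)
        + min (T.card : ℝ) (T'.card : ℝ) * β

variable [DecidableEq V]

theorem collisionProb_eq (E : Ensemble U V) (u u' : U) :
    E.collisionProb u u' = ∑ A ∈ E.carrier, E.prob A * if A u = A u' then 1 else 0 := by
  rw [collisionProb, Finset.sum_filter]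
  refine Finset.sum_congr rfl fun A _ => ?_
  split_ifs <;> simp

theorem sum_imFinset_hits (E : Ensemble U V) {A : U → V} (hA : A ∈ E.carrier) (T : Finset U) :
    ∑ c ∈ E.imFinset, ∑ y ∈ T, (if A y = c then (1 : ℝ) else 0) = T.card := by
  rw [Finset.sum_comm]
  simp [E.apply_mem_imFinset hA]

theorem sum_prob_hits (E : Ensemble U V) (T : Finset U) :
    ∑ A ∈ E.carrier, E.prob A * ∑ c ∈ E.imFinset, ∑ y ∈ T, (if A y = c then (1 : ℝ) else 0) =
      T.card := by
  rw [Finset.sum_congr rfl fun A hA => by rw [E.sum_imFinset_hits hA T], ← Finset.sum_mul,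
    E.prob_sum, one_mul]

theorem sum_imFinset_hits_sq (E : Ensemble U V) {A : U → V} (hA : A ∈ E.carrier) (T : Finset U) :
    ∑ c ∈ E.imFinset, (∑ y ∈ T, (if A y = c then (1 : ℝ) else 0)) ^ 2 =
      ∑ y ∈ T, ∑ y' ∈ T, if A y = A y' then 1 else 0 := by
  simp only [sq, Finset.sum_mul_sum]
  rw [Finset.sum_comm]
  refine Finset.sum_congr rfl fun y _ => ?_
  rw [Finset.sum_comm]
  refine Finset.sum_congr rfl fun y' _ => ?_
  rw [Finset.sum_eq_single (A y)]
  · simp [eq_comm]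
  · intro c _ hc
    simp [hc.symm]
  · exact fun h => absurd (E.apply_mem_imFinset hA y) h

/-- Saturation: a set `T` much larger than `Im 𝒜` meets most of the bins. -/
theorem sum_prob_empty_le [DecidableEq U] (E : Ensemble U V) {α β : ℝ}
    (hE : E.HashBound α β) (T : Finset U) (hT : T.Nonempty) :
    ∑ A ∈ E.carrier, E.prob A *
      ∑ c ∈ E.imFinset, (if ∀ y ∈ T, A y ≠ c then (1 : ℝ) else 0) ≤
      E.im.ncard * (α - 1 + E.im.ncard * (1 + β) / T.card) := by
  have : Nonempty U := ⟨hT.choose⟩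
  have hm : (0 : ℝ) < E.im.ncard := by
    rw [← card_imFinset]; exact_mod_cast E.imFinset_card_pos
  have hT0 : (0 : ℝ) < T.card := by exact_mod_cast hT.card_pos
  set m : ℝ := (E.im.ncard : ℝ) with hmdef
  have h1 : ∀ A ∈ E.carrier, ∑ c ∈ E.imFinset, (if ∀ y ∈ T, A y ≠ c then (1 : ℝ) else 0) ≤
      m - 2 * m + (m / T.card) ^ 2 * ∑ y ∈ T, ∑ y' ∈ T, if A y = A y' then 1 else 0 := by
    intro A hA
    -- Second moment method: if `N` counts the elements of `T` in bin `c`, with mean `|T| / m`, then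
    -- the indicator of `N = 0` is at most `(1 - m N / |T|)²`.
    have h2 : ∀ c ∈ E.imFinset, (if ∀ y ∈ T, A y ≠ c then (1 : ℝ) else 0) ≤
        1 - 2 * (m / T.card) * (∑ y ∈ T, (if A y = c then (1 : ℝ) else 0)) +
          (m / T.card) ^ 2 * (∑ y ∈ T, (if A y = c then (1 : ℝ) else 0)) ^ 2 := by
      intro c _
      split_ifs with h
      · rw [Finset.sum_eq_zero fun y hy => if_neg (h y hy)]; simp
      · nlinarith [sq_nonneg (1 - m / T.card * ∑ y ∈ T, (if A y = c then (1 : ℝ) else 0))]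
    refine (Finset.sum_le_sum h2).trans (le_of_eq ?_)
    rw [Finset.sum_add_distrib, Finset.sum_sub_distrib, ← Finset.mul_sum, ← Finset.mul_sum,
      E.sum_imFinset_hits hA, E.sum_imFinset_hits_sq hA, Finset.sum_const, card_imFinset,
      nsmul_eq_mul, ← hmdef]
    field_simp
  have h3 : ∑ A ∈ E.carrier, E.prob A * ∑ y ∈ T, ∑ y' ∈ T, (if A y = A y' then (1 : ℝ) else 0) =
      ∑ y ∈ T, ∑ y' ∈ T, E.collisionProb y y' := by
    simp only [Finset.mul_sum, collisionProb_eq]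
    rw [Finset.sum_comm]
    refine Finset.sum_congr rfl fun y _ => ?_
    rw [Finset.sum_comm]
  have h4 := hE T T
  rw [Finset.inter_self, min_self, ← h3] at h4
  calc _ ≤ ∑ A ∈ E.carrier, E.prob A * (m - 2 * m + (m / T.card) ^ 2 *
        ∑ y ∈ T, ∑ y' ∈ T, if A y = A y' then 1 else 0) :=
        Finset.sum_le_sum fun A hA => mul_le_mul_of_nonneg_left (h1 A hA) (E.prob_nonneg A hA)
    _ = m - 2 * m + (m / T.card) ^ 2 * ∑ A ∈ E.carrier, E.prob A *
          ∑ y ∈ T, ∑ y' ∈ T, (if A y = A y' then (1 : ℝ) else 0) := by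
        simp only [mul_add, Finset.sum_add_distrib, ← Finset.sum_mul, E.prob_sum, one_mul]
        rw [Finset.mul_sum]
        congr 1
        exact Finset.sum_congr rfl fun A _ => by ring
    _ ≤ m - 2 * m + (m / T.card) ^ 2 * (T.card + T.card * T.card * α / m + T.card * β) := by
        gcongr
    _ = _ := by field_simp; ring

/-- Collision resistance: few elements of a small set collide with a given element. -/
theorem sum_prob_collision_le [DecidableEq U] (E : Ensemble U V) {α β : ℝ}
    (hE : E.HashBound α β) (y : U) (T : Finset U) (hy : y ∉ T) :
    ∑ B ∈ E.carrier, E.prob B * ∑ y' ∈ T, (if B y' = B y then (1 : ℝ) else 0) ≤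
      T.card * |α| / E.im.ncard + |β| := by
  have h1 := hE {y} T
  rw [Finset.singleton_inter_of_notMem hy] at h1
  simp only [Finset.sum_singleton, Finset.card_empty, Nat.cast_zero, Finset.card_singleton,
    Nat.cast_one, one_mul, zero_add] at h1
  have h2 : ∑ B ∈ E.carrier, E.prob B * ∑ y' ∈ T, (if B y' = B y then (1 : ℝ) else 0) =
      ∑ y' ∈ T, E.collisionProb y y' := by
    simp only [Finset.mul_sum, collisionProb_eq]
    rw [Finset.sum_comm]
    simp only [eq_comm]
  rw [h2]
  refine h1.trans (add_le_add ?_ ?_)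
  · gcongr
    exact le_abs_self _
  · have h0 : (0 : ℝ) ≤ min (1 : ℝ) (T.card : ℝ) := le_min zero_le_one (Nat.cast_nonneg _)
    calc _ ≤ min (1 : ℝ) (T.card : ℝ) * |β| := mul_le_mul_of_nonneg_left (le_abs_self _) h0
      _ ≤ 1 * |β| := mul_le_mul_of_nonneg_right (min_le_left _ _) (abs_nonneg _)
      _ = _ := one_mul _

end Ensemble

/-! ### Averages over the random choice of `A`, `B` and `c`. -/

section RandomCode

variable {U VA VB : Type*} [Finite VA] [Finite VB]

/-- The probability of the choice of `A`, `B` and a uniformly distributed `c ∈ Im 𝒜`. -/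
noncomputable def codeWeight (EA : Ensemble U VA) (EB : Ensemble U VB)
    (q : (U → VA) × (U → VB) × VA) : ℝ :=
  EA.prob q.1 * (EB.prob q.2.1 * (EA.im.ncard : ℝ)⁻¹)

/-- The set of choices of `A`, `B` and `c`. -/
noncomputable def codeSet (EA : Ensemble U VA) (EB : Ensemble U VB) :
    Finset ((U → VA) × (U → VB) × VA) :=
  EA.carrier ×ˢ EB.carrier ×ˢ EA.imFinset

variable (EA : Ensemble U VA) (EB : Ensemble U VB)

theorem codeWeight_nonneg {q : (U → VA) × (U → VB) × VA} (hq : q ∈ codeSet EA EB) :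
    0 ≤ codeWeight EA EB q := by
  simp only [codeSet, Finset.mem_product] at hq
  exact mul_nonneg (EA.prob_nonneg _ hq.1) (mul_nonneg (EB.prob_nonneg _ hq.2.1) (by positivity))

theorem sum_codeWeight_mul (F : (U → VA) → (U → VB) → VA → ℝ) :
    ∑ q ∈ codeSet EA EB, codeWeight EA EB q * F q.1 q.2.1 q.2.2 =
      (EA.im.ncard : ℝ)⁻¹ * ∑ A ∈ EA.carrier, EA.prob A *
        ∑ c ∈ EA.imFinset, ∑ B ∈ EB.carrier, EB.prob B * F A B c := by
  simp only [codeSet, codeWeight, Finset.sum_product, Finset.mul_sum]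
  refine Finset.sum_congr rfl fun A _ => ?_
  rw [Finset.sum_comm]
  refine Finset.sum_congr rfl fun c _ => Finset.sum_congr rfl fun B _ => ?_
  ring

theorem sum_codeWeight_mul_of_fst (F : (U → VA) → VA → ℝ) :
    ∑ q ∈ codeSet EA EB, codeWeight EA EB q * F q.1 q.2.2 =
      (EA.im.ncard : ℝ)⁻¹ * ∑ A ∈ EA.carrier, EA.prob A * ∑ c ∈ EA.imFinset, F A c := by
  rw [sum_codeWeight_mul EA EB fun A _ c => F A c]
  simp only [← Finset.sum_mul, EB.prob_sum, one_mul]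

theorem sum_codeWeight [Nonempty U] : ∑ q ∈ codeSet EA EB, codeWeight EA EB q = 1 := by
  have := sum_codeWeight_mul_of_fst EA EB fun _ _ => 1
  simp only [mul_one, Finset.sum_const, nsmul_eq_mul, ← Finset.sum_mul, EA.prob_sum, one_mul,
    EA.card_imFinset] at this
  rw [this, inv_mul_cancel₀]
  rw [← EA.card_imFinset]
  exact_mod_cast EA.imFinset_card_pos.ne'

variable [DecidableEq VA]

theorem sum_codeWeight_empty_le [DecidableEq U] {α β : ℝ} (hE : EA.HashBound α β)
    (T : Finset U) (hT : T.Nonempty) :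
    ∑ q ∈ codeSet EA EB, codeWeight EA EB q *
      (if ∀ y ∈ T, q.1 y ≠ q.2.2 then (1 : ℝ) else 0) ≤
      α - 1 + EA.im.ncard * (1 + β) / T.card := by
  have : Nonempty U := ⟨hT.choose⟩
  have hm : (0 : ℝ) < EA.im.ncard := by
    rw [← EA.card_imFinset]; exact_mod_cast EA.imFinset_card_pos
  rw [sum_codeWeight_mul_of_fst EA EB fun A c => if ∀ y ∈ T, A y ≠ c then (1 : ℝ) else 0,
    inv_mul_le_iff₀ hm]
  exact EA.sum_prob_empty_le hE T hT

theorem sum_codeWeight_hits (T : Finset U) :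
    ∑ q ∈ codeSet EA EB, codeWeight EA EB q *
      ∑ y ∈ T, (if q.1 y = q.2.2 then (1 : ℝ) else 0) = T.card / EA.im.ncard := by
  rw [sum_codeWeight_mul_of_fst EA EB fun A c => ∑ y ∈ T, if A y = c then (1 : ℝ) else 0,
    EA.sum_prob_hits T]
  ring

/-- The encoded sequence `g A c` does not depend on `B`, so for fixed `A` and `c` collision
resistance applies to the part of `T` in bin `c`. Averaging the size of that part over `c` gains the
factor `1 / |Im 𝒜|`. -/
theorem sum_codeWeight_collision_le [DecidableEq VB] [Nonempty U] [DecidableEq U] {α β : ℝ} (hE : EB.HashBound α β)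
    (g : (U → VA) → VA → U) (T : Finset U) :
    ∑ q ∈ codeSet EA EB, codeWeight EA EB q *
      ∑ y ∈ T, (if y ≠ g q.1 q.2.2 ∧ q.1 y = q.2.2 ∧ q.2.1 y = q.2.1 (g q.1 q.2.2)
        then (1 : ℝ) else 0) ≤ T.card * |α| / (EA.im.ncard * EB.im.ncard) + |β| := by
  have hm : (0 : ℝ) < EA.im.ncard := by
    rw [← EA.card_imFinset]; exact_mod_cast EA.imFinset_card_pos
  rw [sum_codeWeight_mul EA EB fun A B c => ∑ y ∈ T, (if y ≠ g A c ∧ A y = c ∧ B y = B (g A c)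
        then (1 : ℝ) else 0), inv_mul_le_iff₀ hm]
  have h1 : ∀ A c, ∑ B ∈ EB.carrier, EB.prob B *
      ∑ y ∈ T, (if y ≠ g A c ∧ A y = c ∧ B y = B (g A c) then (1 : ℝ) else 0) ≤
      (∑ y ∈ T, if A y = c then (1 : ℝ) else 0) * (|α| / EB.im.ncard) + |β| := by
    intro A c
    have := EB.sum_prob_collision_le hE (g A c) (T.filter fun y => y ≠ g A c ∧ A y = c) (by simp)
    simp only [Finset.sum_filter, ← ite_and, and_assoc] at this
    refine this.trans ?_
    rw [mul_div_assoc]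
    gcongr
    rw [Finset.card_filter]
    push_cast
    refine Finset.sum_le_sum fun y _ => ?_
    split_ifs <;> simp_all
  have h2 : ∀ A ∈ EA.carrier, EA.prob A * ∑ c ∈ EA.imFinset, ∑ B ∈ EB.carrier, EB.prob B *
      ∑ y ∈ T, (if y ≠ g A c ∧ A y = c ∧ B y = B (g A c) then (1 : ℝ) else 0) ≤
      EA.prob A * (T.card * (|α| / EB.im.ncard) + EA.im.ncard * |β|) := by
    intro A hA
    refine mul_le_mul_of_nonneg_left ?_ (EA.prob_nonneg A hA)
    refine (Finset.sum_le_sum fun c _ => h1 A c).trans (le_of_eq ?_)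
    rw [Finset.sum_add_distrib, ← Finset.sum_mul, EA.sum_imFinset_hits hA, Finset.sum_const,
      EA.card_imFinset, nsmul_eq_mul]
  refine (Finset.sum_le_sum h2).trans (le_of_eq ?_)
  rw [← Finset.sum_mul, EA.prob_sum]
  field_simp

end RandomCode

/-! ### Error events for one pair of source sequences. -/

section Typical

variable {X Y Z W : Type*} [Fintype X] [Fintype Y] [Fintype Z] {n : ℕ}
  {μ : X × Z → ℝ} {p : X → ℝ} {w : X → Z → ℝ} {κ : X → Y → ℝ} {ρ : X → W → ℝ} {f : Y → Z → W}
  {t e R M s : ℝ}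

/-- The conditional entropy `H(Y|X)` in nats. -/
noncomputable def condEnt (p : X → ℝ) (κ : X → Y → ℝ) : ℝ :=
  ∑ a, p a * ∑ b, Real.negMulLog (κ a b)

/-- The bound for the divergence of the type produced by the encoder. -/
noncomputable def divBound (X : Type*) [Fintype X] (e t M : ℝ) : ℝ :=
  e + 2 * t + 2 * (Fintype.card X * (t * M))

/-- The distortion bound in the absence of errors. -/
noncomputable def distBound (μ : X × Z → ℝ) (κ : X → Y → ℝ) (ρ : X → W → ℝ) (f : Y → Z → W)
    (e t M R : ℝ) : ℝ :=
  expDistortion μ κ ρ f + R * √(divBound X e t M) +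
    (Fintype.card (X × Y × Z) + Fintype.card X) * (t * R)

/-- The bound for the conditional information content (in nats, per letter) of the encoded
sequence given the side information. -/
noncomputable def infoBound (μ : X × Z → ℝ) (κ : X → Y → ℝ) (e t M s : ℝ) : ℝ :=
  condEntropy (jointYZ μ κ) * Real.log 2 + divBound X e t M +
    √(divBound X e t M) * max (Real.log (Fintype.card (Y × Z) / s)) 0 + s +
      (Fintype.card (X × Y × Z) + Fintype.card X) * (t * M)

theorem expDistortion_eq (hμ : ∀ x z, μ (x, z) = p x * w x z) (V : X → Y → ℝ) :
    expDistortion μ V ρ f = ∑ a, p a * ∑ b, V a b * ∑ d, w a d * ρ a (f b d) := by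
  simp only [expDistortion, joint, Finset.mul_sum, hμ]
  exact Finset.sum_congr rfl fun x _ => Finset.sum_congr rfl fun y _ =>
    Finset.sum_congr rfl fun z _ => by ring

theorem sum_jointYZ_mul (hμ : ∀ x z, μ (x, z) = p x * w x z) (V : X → Y → ℝ) (g : Z → Y → ℝ) :
    ∑ z, ∑ y, jointYZ μ V (y, z) * g z y = ∑ a, p a * ∑ b, V a b * ∑ d, w a d * g d b := by
  simp only [jointYZ, joint, Finset.mul_sum, Finset.sum_mul, hμ]
  rw [Finset.sum_comm, Finset.sum_comm' (t' := Finset.univ) (s' := fun _ => Finset.univ) (by simp)]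
  rw [Finset.sum_comm]
  conv_rhs => rw [Finset.sum_comm]
  refine Finset.sum_congr rfl fun y _ => ?_
  rw [Finset.sum_comm]
  exact Finset.sum_congr rfl fun y _ => Finset.sum_congr rfl fun z _ => by ring

theorem condDiv_empCond_le_divBound (hn : 0 < n)
    (hκ : ∀ x, κ x ∈ stdSimplex ℝ Y) (hM : ∀ a b, |Real.log (κ a b)| ≤ M)
    {x : Fin n → X} {y : Fin n → Y} (hx : TypX p t x)
    (hy : ∀ i, κ (x i) (y i) ≠ 0)
    (h1 : ∑ i, -Real.log (κ (x i) (y i)) ≤ n * (condEnt p κ + t + Fintype.card X * (t * M)))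
    (h2 : n * (condEnt p κ - e - t) ≤ empEntropy κ x y) :
    condDiv p (empCond κ x y) κ ≤ divBound X e t M := by
  have := condDiv_empCond_le hn hκ hx hy hM h1 h2
  unfold divBound
  linarith

section Bounds

variable (hn : 0 < n) (hμ : ∀ x z, μ (x, z) = p x * w x z) (hp : p ∈ stdSimplex ℝ X)
  (hw : ∀ x, w x ∈ stdSimplex ℝ Z) (hκ : ∀ x, κ x ∈ stdSimplex ℝ Y)
  (hM : ∀ a b, |Real.log (κ a b)| ≤ M)
include hn hμ hp hw hκ hM

theorem blockDistortion_le_distBound (hρ : ∀ x w, 0 ≤ ρ x w) (hR : ∀ x w, ρ x w ≤ R) (hR0 : 0 ≤ R)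
    {x : Fin n → X} {y : Fin n → Y} {z : Fin n → Z} (hx : TypX p t x)
    (hy : ∀ i, κ (x i) (y i) ≠ 0)
    (h1 : ∑ i, -Real.log (κ (x i) (y i)) ≤ n * (condEnt p κ + t + Fintype.card X * (t * M)))
    (h2 : n * (condEnt p κ - e - t) ≤ empEntropy κ x y) (hz : TypZ w t x y z) :
    blockDistortion ρ x (fun i => f (y i) (z i)) ≤ n * distBound μ κ ρ f e t M R := by
  have h3 := condDiv_empCond_le_divBound hn hκ hM hx hy h1 h2
  have h4 := abs_sum_sub_sum_empCond_le hw hκ hx hz (g := fun a b d => ρ a (f b d)) (G := R)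
    (fun a b d => by rw [abs_of_nonneg (hρ _ _)]; exact hR _ _)
  rw [← expDistortion_eq hμ] at h4
  have h5 := expDistortion_le_add hμ hp hw (empCond_mem_stdSimplex hκ x y) hκ
    (empCond_eq_zero hy) hρ hR hR0 f
  have h6 := mul_le_mul_of_nonneg_left (Real.sqrt_le_sqrt h3) hR0
  have h7 := (abs_le.1 h4).2
  have h8 : expDistortion μ (empCond κ x y) ρ f ≤
      expDistortion μ κ ρ f + R * √(divBound X e t M) := by linarith
  have h9 := mul_le_mul_of_nonneg_left h8 (Nat.cast_nonneg (α := ℝ) n)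
  simp only [blockDistortion, distBound]
  linarith

theorem sum_neg_log_condDist_le [Nonempty Y] [Nonempty Z] (hμs : μ ∈ stdSimplex ℝ (X × Z))
    (hM' : ∀ d b, |Real.log (condDist (jointYZ μ κ) d b)| ≤ M) (hs : 0 < s)
    {x : Fin n → X} {y : Fin n → Y} {z : Fin n → Z} (hx : TypX p t x)
    (hy : ∀ i, κ (x i) (y i) ≠ 0)
    (h1 : ∑ i, -Real.log (κ (x i) (y i)) ≤ n * (condEnt p κ + t + Fintype.card X * (t * M)))
    (h2 : n * (condEnt p κ - e - t) ≤ empEntropy κ x y) (hz : TypZ w t x y z) :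
    ∑ i, -Real.log (condDist (jointYZ μ κ) (z i) (y i)) ≤ n * infoBound μ κ e t M s := by
  have h3 := condDiv_empCond_le_divBound hn hκ hM hx hy h1 h2
  have h4 := abs_sum_sub_sum_empCond_le hw hκ hx hz
    (g := fun a b d => -Real.log (condDist (jointYZ μ κ) d b)) (G := M)
    (fun a b d => by rw [abs_neg]; exact hM' _ _)
  rw [← sum_jointYZ_mul hμ (empCond κ x y)
    (fun d b => -Real.log (condDist (jointYZ μ κ) d b))] at h4
  have h5 := sum_jointYZ_mul_neg_log_condDist_le hμ hμs hp hw (empCond_mem_stdSimplex hκ x y) hκ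
    (empCond_eq_zero hy) hs
  have h6 := mul_le_mul_of_nonneg_right (Real.sqrt_le_sqrt h3)
    (le_max_right (Real.log (Fintype.card (Y × Z) / s)) 0)
  have h7 := (abs_le.1 h4).2
  have h8 := mul_le_mul_of_nonneg_left (h5.trans (add_le_add_left (add_le_add
    (add_le_add_right h3 _) h6) s)) (Nat.cast_nonneg (α := ℝ) n)
  simp only [infoBound]
  linarith

end Bounds

open Classical in
/-- The sequences whose joint type with `x` has a small conditional entropy. -/
noncomputable def lowEntropySet (κ : X → Y → ℝ) (h : ℝ) (x : Fin n → X) : Finset (Fin n → Y) :=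
  Finset.univ.filter fun y => empEntropy κ x y ≤ n * h

open Classical in
/-- The sequences of large likelihood given the side information `z`. -/
noncomputable def likelySet (ν : Z → Y → ℝ) (h : ℝ) (z : Fin n → Z) : Finset (Fin n → Y) :=
  Finset.univ.filter fun y => Real.exp (-(n * h)) ≤ ∏ i, ν (z i) (y i)

/-- Only subprobability is required, because `condDist` vanishes identically at a `z` of probability
zero. -/
theorem card_likelySet_le {ν : Z → Y → ℝ} (hν : ∀ z y, 0 ≤ ν z y) (hν1 : ∀ z, ∑ y, ν z y ≤ 1)
    (h : ℝ) (z : Fin n → Z) : ((likelySet ν h z).card : ℝ) ≤ Real.exp (n * h) := by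
  have h1 : ((likelySet ν h z).card : ℝ) * Real.exp (-(n * h)) ≤
      ∑ y : Fin n → Y, ∏ i, ν (z i) (y i) := by
    refine le_trans ?_ (Finset.sum_le_univ_sum_of_nonneg (s := likelySet ν h z)
      fun y => Finset.prod_nonneg fun i _ => hν _ _)
    rw [← nsmul_eq_mul]
    refine Finset.card_nsmul_le_sum _ _ _ fun y hy => ?_
    simp only [likelySet, Finset.mem_filter] at hy
    exact hy.2
  rw [sum_prod_eq_prod_sum fun i => ν (z i)] at h1
  have h2 : ∏ i, ∑ y, ν (z i) y ≤ 1 :=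
    Finset.prod_le_one (fun i _ => Finset.sum_nonneg fun y _ => hν _ _) fun i _ => hν1 _
  rw [Real.exp_neg, ← div_eq_mul_inv] at h1
  exact (div_le_one (Real.exp_pos _)).1 (h1.trans h2)

theorem condDist_nonneg {U V : Type*} [Fintype U] [Fintype V] {P : U × V → ℝ}
    (hP : ∀ p, 0 ≤ P p) (v : V) (u : U) : 0 ≤ condDist P v u :=
  div_nonneg (hP _) (Finset.sum_nonneg fun _ _ => hP _)

theorem sum_condDist_le_one {U V : Type*} [Fintype U] [Fintype V] (P : U × V → ℝ) (v : V) :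
    ∑ u, condDist P v u ≤ 1 := by
  simp only [condDist, ← Finset.sum_div]
  exact div_self_le_one _

theorem condDist_jointYZ_ne_zero (hμ0 : ∀ q, 0 ≤ μ q) (hκ : ∀ x, κ x ∈ stdSimplex ℝ Y)
    {a : X} {b : Y} {d : Z} (h1 : μ (a, d) ≠ 0) (h2 : κ a b ≠ 0) :
    condDist (jointYZ μ κ) d b ≠ 0 := by
  have h3 : jointYZ μ κ (b, d) ≠ 0 := by
    intro h
    have := (Finset.sum_eq_zero_iff_of_nonneg
      fun x _ => mul_nonneg (hμ0 (x, d)) ((hκ x).1 b)).1 h a (Finset.mem_univ a)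
    exact (mul_ne_zero h1 h2) this
  refine div_ne_zero h3 fun h => h3 ?_
  exact (Finset.sum_eq_zero_iff_of_nonneg fun y _ =>
    Finset.sum_nonneg fun x _ => mul_nonneg (hμ0 (x, d)) ((hκ x).1 y)).1 h b (Finset.mem_univ b)

theorem distBound_nonneg (hμ0 : ∀ q, 0 ≤ μ q) (hκ : ∀ x, κ x ∈ stdSimplex ℝ Y)
    (hρ : ∀ x w, 0 ≤ ρ x w) (hR0 : 0 ≤ R) (ht : 0 ≤ t) : 0 ≤ distBound μ κ ρ f e t M R := by
  have h1 : 0 ≤ expDistortion μ κ ρ f := Finset.sum_nonneg fun x _ => Finset.sum_nonneg fun y _ =>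
    Finset.sum_nonneg fun z _ => mul_nonneg (mul_nonneg (hμ0 _) ((hκ x).1 _)) (hρ _ _)
  unfold distBound
  positivity

open Classical in
/-- The distortion of the code for one pair of source sequences is bounded in terms of the
indicators of the five error events. -/
theorem blockDistortion_code_le [Nonempty Y] [Nonempty Z] {VA VB : Type*}
    (hn : 0 < n) (hμ : ∀ x z, μ (x, z) = p x * w x z)
    (hμs : μ ∈ stdSimplex ℝ (X × Z)) (hp : p ∈ stdSimplex ℝ X)
    (hw : ∀ x, w x ∈ stdSimplex ℝ Z) (hκ : ∀ x, κ x ∈ stdSimplex ℝ Y)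
    (hM : ∀ a b, |Real.log (κ a b)| ≤ M)
    (hM' : ∀ d b, |Real.log (condDist (jointYZ μ κ) d b)| ≤ M)
    (hρ : ∀ x w, 0 ≤ ρ x w) (hR : ∀ x w, ρ x w ≤ R) (hR0 : 0 ≤ R) (hs : 0 < s) (ht : 0 < t)
    {x : Fin n → X} {z : Fin n → Z} (hxz : ∀ i, μ (x i, z i) ≠ 0)
    {A : (Fin n → Y) → VA} {B : (Fin n → Y) → VB} {c : VA} {y y' : Fin n → Y}
    (hy : IsArgMax {y | A y = c} (fun y => ∏ i, κ (x i) (y i)) y)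
    (hy' : IsArgMax {v | A v = c ∧ B v = B y}
      (fun v => ∏ i, condDist (jointYZ μ κ) (z i) (v i)) y') :
    blockDistortion ρ x (fun i => f (y' i) (z i)) ≤ n * (distBound μ κ ρ f e t M R + R *
      ((if ¬ TypX p t x then 1 else 0) +
       (if TypX p t x then if ∀ v ∈ entTyp κ t x, A v ≠ c then 1 else 0 else 0) +
       (∑ v ∈ lowEntropySet κ (condEnt p κ - e - t) x, if A v = c then 1 else 0) +
       (if ¬ TypZ w t x y z then 1 else 0) +
       (∑ v ∈ likelySet (condDist (jointYZ μ κ)) (infoBound μ κ e t M s) z,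
          if v ≠ y ∧ A v = c ∧ B v = B y then 1 else 0))) := by
  have hn' : (0 : ℝ) < n := by exact_mod_cast hn
  have hblock : blockDistortion ρ x (fun i => f (y' i) (z i)) ≤ n * R := by
    rw [blockDistortion]
    refine (Finset.sum_le_sum fun i _ => hR _ _).trans ?_
    simp
  have hE0 := distBound_nonneg (f := f) (e := e) (M := M) hμs.1 hκ hρ hR0 ht.le
  set E0 := distBound μ κ ρ f e t M R
  set i1 : ℝ := if ¬ TypX p t x then 1 else 0 with hi1
  set i2 : ℝ := if TypX p t x then if ∀ v ∈ entTyp κ t x, A v ≠ c then 1 else 0 else 0 with hi2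
  set i3 : ℝ := ∑ v ∈ lowEntropySet κ (condEnt p κ - e - t) x, if A v = c then 1 else 0 with hi3
  set i4 : ℝ := if ¬ TypZ w t x y z then 1 else 0 with hi4
  set i5 : ℝ := ∑ v ∈ likelySet (condDist (jointYZ μ κ)) (infoBound μ κ e t M s) z,
    if v ≠ y ∧ A v = c ∧ B v = B y then 1 else 0 with hi5
  have h1 : 0 ≤ i1 := by rw [hi1]; split_ifs <;> norm_num
  have h2 : 0 ≤ i2 := by rw [hi2]; split_ifs <;> norm_num
  have h3 : 0 ≤ i3 := Finset.sum_nonneg fun v _ => by split_ifs <;> norm_num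
  have h4 : 0 ≤ i4 := by rw [hi4]; split_ifs <;> norm_num
  have h5 : 0 ≤ i5 := Finset.sum_nonneg fun v _ => by split_ifs <;> norm_num
  -- Once some error event occurs, the trivial bound `n * R` is already enough.
  have herr : 1 ≤ i1 + i2 + i3 + i4 + i5 → blockDistortion ρ x (fun i => f (y' i) (z i)) ≤
      n * (E0 + R * (i1 + i2 + i3 + i4 + i5)) := fun h => hblock.trans
    (mul_le_mul_of_nonneg_left (by nlinarith) hn'.le)
  by_cases c1 : TypX p t x
  swap
  · refine herr ?_
    have : i1 = 1 := by rw [hi1, if_pos c1]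
    linarith
  by_cases c2 : ∀ v ∈ entTyp κ t x, A v ≠ c
  · refine herr ?_
    have : i2 = 1 := by rw [hi2, if_pos c1, if_pos c2]
    linarith
  push Not at c2
  obtain ⟨y0, hy0, hAy0⟩ := c2
  obtain ⟨hAy, hmax⟩ := hy ⟨y0, hAy0⟩
  rw [Set.mem_ofPred_eq] at hAy
  simp only [entTyp, Finset.mem_filter, Finset.mem_univ, true_and] at hy0
  have hle := hmax y0 hAy0
  simp only [] at hle
  have hyne : ∀ i, κ (x i) (y i) ≠ 0 := by
    have : 0 < ∏ i, κ (x i) (y i) := by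
      refine lt_of_lt_of_le ?_ hle
      rw [prod_eq_exp_of_ne_zero hκ hy0.1]
      exact Real.exp_pos _
    intro i hi
    exact this.ne' (Finset.prod_eq_zero (Finset.mem_univ i) hi)
  -- The encoder maximizes likelihood over a bin containing the typical `y0`, so `y` is at least as
  -- likely as `y0`.
  have hlik : ∑ i, -Real.log (κ (x i) (y i)) ≤
      n * (condEnt p κ + t + Fintype.card X * (t * M)) := by
    rw [prod_eq_exp_of_ne_zero hκ hyne, prod_eq_exp_of_ne_zero hκ hy0.1, Real.exp_le_exp] at hle
    have b1 := (abs_lt.1 hy0.2).2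
    have b2 := c1.abs_sum_sub_le (g := fun a => ∑ b, Real.negMulLog (κ a b)) (G := M) (fun a => by
      have := abs_sum_mul_le (g := fun b => -Real.log (κ a b)) (hκ a) fun b => by
        rw [abs_neg]; exact hM a b
      simpa [Real.negMulLog] using this)
    have b3 := (abs_le.1 b2).2
    rw [← condEnt] at b3
    linarith
  by_cases c3 : y ∈ lowEntropySet κ (condEnt p κ - e - t) x
  · refine herr ?_
    have : 1 ≤ i3 := by
      have : (if A y = c then (1 : ℝ) else 0) ≤ i3 :=
        Finset.single_le_sum (f := fun v => if A v = c then (1 : ℝ) else 0)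
          (fun v _ => by split_ifs <;> norm_num) c3
      rwa [if_pos hAy] at this
    linarith
  have hent : n * (condEnt p κ - e - t) ≤ empEntropy κ x y := by
    simp only [lowEntropySet, Finset.mem_filter, Finset.mem_univ, true_and, not_le] at c3
    exact c3.le
  by_cases c4 : TypZ w t x y z
  swap
  · refine herr ?_
    have : i4 = 1 := by rw [hi4, if_pos c4]
    linarith
  have hinfo := sum_neg_log_condDist_le hn hμ hp hw hκ hM hμs hM' hs c1 hyne hlik hent c4
  obtain ⟨hAB, hmax'⟩ := hy' ⟨y, hAy, rfl⟩
  by_cases c5 : y' = y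
  · rw [c5]
    refine (blockDistortion_le_distBound hn hμ hp hw hκ hM hρ hR hR0 c1 hyne hlik hent
      c4).trans (mul_le_mul_of_nonneg_left ?_ hn'.le)
    have : 0 ≤ R * (i1 + i2 + i3 + i4 + i5) := by positivity
    linarith
  refine herr ?_
  -- The true `y` competes in the decoder's search, so the output `y'` is at least as likely given
  -- `z`.
  have hmem : y' ∈ likelySet (condDist (jointYZ μ κ)) (infoBound μ κ e t M s) z := by
    simp only [likelySet, Finset.mem_filter, Finset.mem_univ, true_and]
    refine le_trans ?_ (hmax' y ⟨hAy, rfl⟩)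
    have : ∏ i, condDist (jointYZ μ κ) (z i) (y i) =
        Real.exp (-∑ i, -Real.log (condDist (jointYZ μ κ) (z i) (y i))) := by
      rw [← Finset.sum_neg_distrib, Real.exp_sum]
      refine Finset.prod_congr rfl fun i _ => ?_
      rw [neg_neg, Real.exp_log]
      exact (condDist_nonneg (jointYZ_mem_stdSimplex hμs hκ).1 _ _).lt_of_ne
        (condDist_jointYZ_ne_zero hμs.1 hκ (hxz i) (hyne i)).symm
    simp only [this]
    exact Real.exp_le_exp.2 (by linarith)
  have : 1 ≤ i5 := by
    have : (if y' ≠ y ∧ A y' = c ∧ B y' = B y then (1 : ℝ) else 0) ≤ i5 :=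
      Finset.single_le_sum (f := fun v => if v ≠ y ∧ A v = c ∧ B v = B y then (1 : ℝ) else 0)
        (fun v _ => by split_ifs <;> norm_num) hmem
    rwa [if_pos ⟨c5, hAB⟩] at this
  linarith

end Typical

/-! ### The random coding average at a fixed block length. -/

theorem exists_le_of_sum_weight_mul_le {ι : Type*} {S : Finset ι} {ω F : ι → ℝ}
    (hω : ∀ q ∈ S, 0 ≤ ω q) (hω1 : ∑ q ∈ S, ω q = 1) {C : ℝ} (h : ∑ q ∈ S, ω q * F q ≤ C) :
    ∃ q ∈ S, F q ≤ C := by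
  by_contra hc
  push Not at hc
  have h1 : ∑ q ∈ S, ω q * (F q - C) ≤ 0 := by
    simp only [mul_sub, Finset.sum_sub_distrib, ← Finset.sum_mul, hω1, one_mul]
    linarith
  have h2 : ∀ q ∈ S, 0 ≤ ω q * (F q - C) := fun q hq =>
    mul_nonneg (hω q hq) (sub_nonneg.2 (hc q hq).le)
  have h3 := (Finset.sum_eq_zero_iff_of_nonneg h2).1 (le_antisymm h1 (Finset.sum_nonneg h2))
  have h4 : ∑ q ∈ S, ω q = 0 := Finset.sum_eq_zero fun q hq =>
    (mul_eq_zero.1 (h3 q hq)).resolve_right (sub_pos.2 (hc q hq)).ne'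
  linarith

theorem sum_mul_sum_comm {ι U V : Type*} [Fintype U] [Fintype V] (S : Finset ι) (ω : ι → ℝ)
    (P : U → V → ℝ) (F : ι → U → V → ℝ) :
    ∑ q ∈ S, ω q * ∑ x, ∑ z, P x z * F q x z = ∑ x, ∑ z, P x z * ∑ q ∈ S, ω q * F q x z := by
  simp only [Finset.mul_sum]
  rw [Finset.sum_comm]
  refine Finset.sum_congr rfl fun x _ => ?_
  rw [Finset.sum_comm]
  refine Finset.sum_congr rfl fun z _ => Finset.sum_congr rfl fun q _ => ?_
  ring

section Average

variable {X Y Z W : Type*} [Fintype X] [Fintype Y] [Fintype Z] {n : ℕ}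
  {μ : X × Z → ℝ} {p : X → ℝ} {w : X → Z → ℝ} {κ : X → Y → ℝ} {ρ : X → W → ℝ} {f : Y → Z → W}
  {t e R M s : ℝ}

theorem sum_sum_prod (hμ : ∀ x z, μ (x, z) = p x * w x z) (F : (Fin n → X) → (Fin n → Z) → ℝ) :
    ∑ x : Fin n → X, ∑ z : Fin n → Z, (∏ i, μ (x i, z i)) * F x z =
      ∑ x : Fin n → X, (∏ i, p (x i)) * ∑ z : Fin n → Z, (∏ i, w (x i) (z i)) * F x z := by
  simp only [hμ, Finset.prod_mul_distrib, Finset.mul_sum, mul_assoc]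

theorem sum_sum_prod_le (hμ : ∀ x z, μ (x, z) = p x * w x z)
    (hp : p ∈ stdSimplex ℝ X)
    {F : (Fin n → X) → (Fin n → Z) → ℝ} {b : ℝ}
    (h : ∀ x, ∑ z : Fin n → Z, (∏ i, w (x i) (z i)) * F x z ≤ b) :
    ∑ x : Fin n → X, ∑ z : Fin n → Z, (∏ i, μ (x i, z i)) * F x z ≤ b := by
  rw [sum_sum_prod hμ]
  calc _ ≤ ∑ x : Fin n → X, (∏ i, p (x i)) * b := Finset.sum_le_sum fun x _ =>
        mul_le_mul_of_nonneg_left (h x) (Finset.prod_nonneg fun i _ => hp.1 _)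
    _ = b := by
        rw [← Finset.sum_mul, sum_prod_eq_one (fun _ => p) (fun _ => hp.2), one_mul]

open Classical in
/-- The random coding argument at a fixed block length. -/
theorem exists_code [Nonempty Y] [Nonempty Z] {VA VB : Type*} [Finite VA] [Finite VB]
    (hn : 0 < n) (hμ : ∀ x z, μ (x, z) = p x * w x z)
    (hμs : μ ∈ stdSimplex ℝ (X × Z)) (hp : p ∈ stdSimplex ℝ X)
    (hw : ∀ x, w x ∈ stdSimplex ℝ Z) (hκ : ∀ x, κ x ∈ stdSimplex ℝ Y)
    (hM : ∀ a b, |Real.log (κ a b)| ≤ M)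
    (hM' : ∀ d b, |Real.log (condDist (jointYZ μ κ) d b)| ≤ M)
    (hρ : ∀ x w, 0 ≤ ρ x w) (hR : ∀ x w, ρ x w ≤ R) (hR0 : 0 ≤ R) (hs : 0 < s) (ht : 0 < t)
    (EA : Ensemble (Fin n → Y) VA) (EB : Ensemble (Fin n → Y) VB)
    {gA : ((Fin n → Y) → VA) → VA → (Fin n → X) → (Fin n → Y)}
    (hgA : ∀ A c x, IsArgMax {y | A y = c} (fun y => ∏ i, κ (x i) (y i)) (gA A c x))
    {gAB : ((Fin n → Y) → VA) → ((Fin n → Y) → VB) → VA → VB → (Fin n → Z) → (Fin n → Y)}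
    (hgAB : ∀ A B c b z, IsArgMax {y | A y = c ∧ B y = b}
      (fun y => ∏ i, condDist (jointYZ μ κ) (z i) (y i)) (gAB A B c b z))
    {αB βB b₂ b₃ b₅ : ℝ} (hB : EB.HashBound αB βB)
    (h2 : ∀ x, TypX p t x → ∑ q ∈ codeSet EA EB, codeWeight EA EB q *
      (if ∀ v ∈ entTyp κ t x, q.1 v ≠ q.2.2 then (1 : ℝ) else 0) ≤ b₂) (h20 : 0 ≤ b₂)
    (h3 : ∀ x : Fin n → X,
      ((lowEntropySet κ (condEnt p κ - e - t) x).card : ℝ) / EA.im.ncard ≤ b₃)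
    (h5 : ∀ z : Fin n → Z, ((likelySet (condDist (jointYZ μ κ)) (infoBound μ κ e t M s) z).card : ℝ)
      * |αB| / (EA.im.ncard * EB.im.ncard) + |βB| ≤ b₅) :
    ∃ A ∈ EA.carrier, ∃ B ∈ EB.carrier, ∃ c ∈ EA.im,
      (∑ x : Fin n → X, ∑ z : Fin n → Z, (∏ i, μ (x i, z i)) *
        blockDistortion ρ x (fun i => f (gAB A B c (B (gA A c x)) z i) (z i))) / n ≤
      distBound μ κ ρ f e t M R + R * (Fintype.card X / (n * t ^ 2) + b₂ + b₃ +
        Fintype.card (X × Y × Z) / (n * t ^ 2) + b₅) := by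
  have hn' : (0 : ℝ) < n := by exact_mod_cast hn
  set S := codeSet EA EB with hS
  set ω := codeWeight EA EB with hω
  have hω1 : ∑ q ∈ S, ω q = 1 := sum_codeWeight EA EB
  have hω0 : ∀ q ∈ S, 0 ≤ ω q := fun q hq => codeWeight_nonneg EA EB hq
  set P : (Fin n → X) → (Fin n → Z) → ℝ := fun x z => ∏ i, μ (x i, z i) with hP
  have hP0 : ∀ x z, 0 ≤ P x z := fun x z => Finset.prod_nonneg fun i _ => hμs.1 _
  have hw1 : ∀ x : Fin n → X, ∑ z : Fin n → Z, ∏ i, w (x i) (z i) = 1 := fun x =>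
    sum_prod_eq_one (fun i => w (x i)) fun i => (hw _).2
  have hP1 : ∑ x, ∑ z, P x z = 1 := by
    have := sum_sum_prod hμ (n := n) (fun _ _ => 1)
    simp only [mul_one, hw1] at this
    rw [this]
    exact sum_prod_eq_one (fun _ => p) fun _ => hp.2
  have hPle : ∀ (F : (Fin n → X) → (Fin n → Z) → ℝ) (b : ℝ), (∀ x z, F x z ≤ b) →
      ∑ x, ∑ z, P x z * F x z ≤ b := by
    intro F b hF
    calc _ ≤ ∑ x, ∑ z, P x z * b := Finset.sum_le_sum fun x _ => Finset.sum_le_sum fun z _ =>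
          mul_le_mul_of_nonneg_left (hF x z) (hP0 x z)
      _ = b := by simp only [← Finset.sum_mul, hP1, one_mul]
  set F1 : (Fin n → X) → ℝ := fun x => if ¬ TypX p t x then 1 else 0 with hF1
  set F2 : ((Fin n → Y) → VA) × ((Fin n → Y) → VB) × VA → (Fin n → X) → ℝ := fun q x =>
    if TypX p t x then if ∀ v ∈ entTyp κ t x, q.1 v ≠ q.2.2 then 1 else 0 else 0 with hF2
  set F3 : ((Fin n → Y) → VA) × ((Fin n → Y) → VB) × VA → (Fin n → X) → ℝ := fun q x =>
    ∑ v ∈ lowEntropySet κ (condEnt p κ - e - t) x, if q.1 v = q.2.2 then 1 else 0 with hF3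
  set F4 : ((Fin n → Y) → VA) × ((Fin n → Y) → VB) × VA → (Fin n → X) → (Fin n → Z) → ℝ :=
    fun q x z => if ¬ TypZ w t x (gA q.1 q.2.2 x) z then 1 else 0 with hF4
  set F5 : ((Fin n → Y) → VA) × ((Fin n → Y) → VB) × VA → (Fin n → X) → (Fin n → Z) → ℝ :=
    fun q x z => ∑ v ∈ likelySet (condDist (jointYZ μ κ)) (infoBound μ κ e t M s) z,
      if v ≠ gA q.1 q.2.2 x ∧ q.1 v = q.2.2 ∧ q.2.1 v = q.2.1 (gA q.1 q.2.2 x)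
        then 1 else 0 with hF5
  have k1 : ∑ q ∈ S, ω q * ∑ x, ∑ z, P x z * F1 x ≤ Fintype.card X / (n * t ^ 2) := by
    rw [← Finset.sum_mul, hω1, one_mul, sum_sum_prod hμ (fun x _ => F1 x)]
    refine le_trans (le_of_eq ?_) (sum_not_typX_le hn hp ht)
    rw [Finset.sum_filter]
    refine Finset.sum_congr rfl fun x _ => ?_
    rw [← Finset.sum_mul, hw1, one_mul, hF1]
    simp only [mul_ite, mul_one, mul_zero]
  have k2 : ∑ q ∈ S, ω q * ∑ x, ∑ z, P x z * F2 q x ≤ b₂ := by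
    rw [sum_mul_sum_comm S ω P fun q x _ => F2 q x]
    refine hPle (fun x _ => ∑ q ∈ S, ω q * F2 q x) _ fun x _ => ?_
    by_cases hx : TypX p t x
    · simp only [hF2, if_pos hx]
      exact h2 x hx
    · simp only [hF2, if_neg hx, mul_zero, Finset.sum_const_zero]
      exact h20
  have k3 : ∑ q ∈ S, ω q * ∑ x, ∑ z, P x z * F3 q x ≤ b₃ := by
    rw [sum_mul_sum_comm S ω P fun q x _ => F3 q x]
    refine hPle (fun x _ => ∑ q ∈ S, ω q * F3 q x) _ fun x _ => ?_
    exact (sum_codeWeight_hits EA EB _).le.trans (h3 x)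
  -- For a fixed code, `y` is a function of `x` alone, so the sum over `z` is still against the
  -- product of the `w (x i)`.
  have k4 : ∑ q ∈ S, ω q * ∑ x, ∑ z, P x z * F4 q x z ≤
      Fintype.card (X × Y × Z) / (n * t ^ 2) := by
    rw [← one_mul ((Fintype.card (X × Y × Z) : ℝ) / (n * t ^ 2)), ← hω1, Finset.sum_mul]
    refine Finset.sum_le_sum fun q hq => mul_le_mul_of_nonneg_left ?_ (hω0 q hq)
    refine sum_sum_prod_le hμ hp fun x => ?_
    refine le_trans (le_of_eq ?_) (sum_not_typZ_le hn hw ht x (gA q.1 q.2.2 x))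
    rw [Finset.sum_filter]
    refine Finset.sum_congr rfl fun z _ => ?_
    simp only [hF4, mul_ite, mul_one, mul_zero]
  have k5 : ∑ q ∈ S, ω q * ∑ x, ∑ z, P x z * F5 q x z ≤ b₅ := by
    rw [sum_mul_sum_comm S ω P F5]
    refine hPle (fun x z => ∑ q ∈ S, ω q * F5 q x z) _ fun x z => ?_
    exact (sum_codeWeight_collision_le EA EB hB (fun A c => gA A c x) _).trans (h5 z)
  set E0 := distBound μ κ ρ f e t M R
  have key : ∀ q ∈ S, (∑ x, ∑ z, P x z * blockDistortion ρ x
      (fun i => f (gAB q.1 q.2.1 q.2.2 (q.2.1 (gA q.1 q.2.2 x)) z i) (z i))) / n ≤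
      E0 + R * (∑ x, ∑ z, P x z * F1 x + ∑ x, ∑ z, P x z * F2 q x + ∑ x, ∑ z, P x z * F3 q x +
        ∑ x, ∑ z, P x z * F4 q x z + ∑ x, ∑ z, P x z * F5 q x z) := by
    intro q _
    rw [div_le_iff₀ hn']
    have h1 : ∀ x z, P x z * blockDistortion ρ x
        (fun i => f (gAB q.1 q.2.1 q.2.2 (q.2.1 (gA q.1 q.2.2 x)) z i) (z i)) ≤
        P x z * (n * (E0 + R * (F1 x + F2 q x + F3 q x + F4 q x z + F5 q x z))) := by
      intro x z
      -- Pairs of probability zero are set aside: for them the likelihood of `y` given `z` could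
      -- vanish.
      by_cases h0 : P x z = 0
      · rw [h0, zero_mul, zero_mul]
      refine mul_le_mul_of_nonneg_left ?_ (hP0 x z)
      exact blockDistortion_code_le hn hμ hμs hp hw hκ hM hM' hρ hR hR0 hs ht
        (fun i hi => h0 (Finset.prod_eq_zero (Finset.mem_univ i) hi)) (hgA _ _ _) (hgAB _ _ _ _ _)
    refine (Finset.sum_le_sum fun x _ => Finset.sum_le_sum fun z _ => h1 x z).trans (le_of_eq ?_)
    calc _ = ∑ x, ∑ z, (n * (E0 * P x z) + (n * (R * (P x z * F1 x)) + n * (R * (P x z * F2 q x)) +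
            n * (R * (P x z * F3 q x)) + n * (R * (P x z * F4 q x z)) +
            n * (R * (P x z * F5 q x z)))) :=
          Finset.sum_congr rfl fun x _ => Finset.sum_congr rfl fun z _ => by ring
      _ = _ := by
          simp only [Finset.sum_add_distrib, ← Finset.mul_sum, hP1]
          ring
  obtain ⟨q, hq, hle⟩ := exists_le_of_sum_weight_mul_le hω0 hω1
    (F := fun q => E0 + R * (∑ x, ∑ z, P x z * F1 x + ∑ x, ∑ z, P x z * F2 q x +
      ∑ x, ∑ z, P x z * F3 q x + ∑ x, ∑ z, P x z * F4 q x z + ∑ x, ∑ z, P x z * F5 q x z))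
    (C := E0 + R * (Fintype.card X / (n * t ^ 2) + b₂ + b₃ +
        Fintype.card (X × Y × Z) / (n * t ^ 2) + b₅)) (by
      calc _ = ∑ q ∈ S, (E0 * ω q + (R * (ω q * ∑ x, ∑ z, P x z * F1 x) +
            R * (ω q * ∑ x, ∑ z, P x z * F2 q x) + R * (ω q * ∑ x, ∑ z, P x z * F3 q x) +
            R * (ω q * ∑ x, ∑ z, P x z * F4 q x z) + R * (ω q * ∑ x, ∑ z, P x z * F5 q x z))) :=
            Finset.sum_congr rfl fun q _ => by ring
        _ = E0 + R * (∑ q ∈ S, ω q * ∑ x, ∑ z, P x z * F1 x +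
            ∑ q ∈ S, ω q * ∑ x, ∑ z, P x z * F2 q x + ∑ q ∈ S, ω q * ∑ x, ∑ z, P x z * F3 q x +
            ∑ q ∈ S, ω q * ∑ x, ∑ z, P x z * F4 q x z +
            ∑ q ∈ S, ω q * ∑ x, ∑ z, P x z * F5 q x z) := by
            rw [Finset.sum_add_distrib, ← Finset.mul_sum, hω1, Finset.sum_add_distrib,
              Finset.sum_add_distrib, Finset.sum_add_distrib, Finset.sum_add_distrib,
              ← Finset.mul_sum, ← Finset.mul_sum, ← Finset.mul_sum, ← Finset.mul_sum,
              ← Finset.mul_sum]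
            ring
        _ ≤ _ := by gcongr)
  have hq' := hq
  simp only [hS, codeSet, Finset.mem_product, Ensemble.mem_imFinset] at hq'
  exact ⟨q.1, hq'.1, q.2.1, hq'.2.1, q.2.2, hq'.2.2, (key q hq).trans hle⟩

end Average

/-! ### Entropy identities and code lengths. -/

section Rate

variable {X Y Z W : Type*} [Fintype X] [Fintype Y] [Fintype Z]
  {μ : X × Z → ℝ} {p : X → ℝ} {w : X → Z → ℝ} {κ : X → Y → ℝ}

/-- An `x` of probability zero gets a point mass, so that every `w x` is a genuine distribution. -/
theorem exists_disintegration [Nonempty Z] {μ : X × Z → ℝ} (hμ : μ ∈ stdSimplex ℝ (X × Z)) :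
    ∃ p ∈ stdSimplex ℝ X, ∃ w : X → Z → ℝ, (∀ x, w x ∈ stdSimplex ℝ Z) ∧
      ∀ x z, μ (x, z) = p x * w x z := by
  classical
  refine ⟨fun x => ∑ z, μ (x, z), ⟨fun x => Finset.sum_nonneg fun z _ => hμ.1 _, ?_⟩,
    fun x => if ∑ z, μ (x, z) = 0 then Pi.single (Classical.arbitrary Z) 1
      else fun z => μ (x, z) / ∑ z, μ (x, z), fun x => ?_, fun x z => ?_⟩
  · rw [← hμ.2, Fintype.sum_prod_type]
  · dsimp only
    split_ifs with h
    · exact single_mem_stdSimplex ℝ _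
    · refine ⟨fun z => div_nonneg (hμ.1 _) (Finset.sum_nonneg fun z _ => hμ.1 _), ?_⟩
      rw [← Finset.sum_div, div_self h]
  · dsimp only
    split_ifs with h
    · rw [h, zero_mul]
      exact (Finset.sum_eq_zero_iff_of_nonneg fun z _ => hμ.1 (x, z)).1 h z (Finset.mem_univ z)
    · rw [mul_div_cancel₀ _ h]

theorem entropy_mul_log_two {U : Type*} [Fintype U] (P : U → ℝ) :
    entropy P * Real.log 2 = ∑ u, Real.negMulLog (P u) := by
  have h2 : Real.log 2 ≠ 0 := (Real.log_pos (by norm_num)).ne'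
  rw [entropy, Finset.sum_mul]
  refine Finset.sum_congr rfl fun u _ => ?_
  rw [one_div, Real.logb, Real.log_inv, Real.negMulLog]
  field_simp

/-- The chain rule for the entropy. -/
theorem condEntropy_mul_log_two_eq_sub {U V : Type*} [Fintype U] [Fintype V] {P : U × V → ℝ}
    (hP : ∀ p, 0 ≤ P p) : condEntropy P * Real.log 2 =
      ∑ q, Real.negMulLog (P q) - ∑ v, Real.negMulLog (margSnd P v) := by
  rw [condEntropy_mul_log_two hP, Fintype.sum_prod_type_right, ← Finset.sum_sub_distrib]
  refine Finset.sum_congr rfl fun v _ => ?_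
  have h1 : Real.negMulLog (margSnd P v) = ∑ u, P (u, v) * -Real.log (margSnd P v) := by
    rw [← Finset.sum_mul, ← margSnd, Real.negMulLog]; ring
  rw [h1, ← Finset.sum_sub_distrib]
  refine Finset.sum_congr rfl fun u _ => ?_
  by_cases h0 : P (u, v) = 0
  · simp [h0]
  have h2 : margSnd P v ≠ 0 := fun h =>
    h0 ((Finset.sum_eq_zero_iff_of_nonneg fun u _ => hP (u, v)).1 h u (Finset.mem_univ u))
  rw [condDist, Real.log_div h0 h2, Real.negMulLog]
  ring

/-- By the chain rule both mutual informations contain `H(Y)`, which cancels. -/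
theorem wzInfo_eq (hμ : μ ∈ stdSimplex ℝ (X × Z)) (hκ : ∀ x, κ x ∈ stdSimplex ℝ Y) :
    wzInfo μ κ = condEntropy (jointYZ μ κ) - condEntropy (jointYX μ κ) := by
  have hj : ∀ x y z, 0 ≤ joint μ κ x y z := fun x y z => mul_nonneg (hμ.1 _) ((hκ x).1 y)
  have h1 := condEntropy_mul_log_two_eq_sub (P := jointXY μ κ)
    fun q => Finset.sum_nonneg fun z _ => hj _ _ _
  have h2 := condEntropy_mul_log_two_eq_sub (P := jointYX μ κ)
    fun q => Finset.sum_nonneg fun z _ => hj _ _ _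
  have h3 := entropy_mul_log_two (margFst (jointXY μ κ))
  have h4 := entropy_mul_log_two (margFst (jointYZ μ κ))
  have e1 : margSnd (jointXY μ κ) = margFst (jointYZ μ κ) := by
    funext y
    simp only [margSnd, margFst, jointXY, jointYZ]
    rw [Finset.sum_comm]
  have e2 : margSnd (jointYX μ κ) = margFst (jointXY μ κ) := rfl
  have e3 : ∑ q, Real.negMulLog (jointXY μ κ q) = ∑ q, Real.negMulLog (jointYX μ κ q) := by
    rw [Fintype.sum_prod_type, Fintype.sum_prod_type_right]
    rfl
  rw [e1] at h1
  rw [e2] at h2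
  have hL : Real.log 2 ≠ 0 := (Real.log_pos (by norm_num)).ne'
  apply mul_right_cancel₀ hL
  simp only [wzInfo, mutualInfo]
  linarith

theorem condEntropy_jointYX (hμ : ∀ x z, μ (x, z) = p x * w x z) (hp : p ∈ stdSimplex ℝ X)
    (hw : ∀ x, w x ∈ stdSimplex ℝ Z) (hκ : ∀ x, κ x ∈ stdSimplex ℝ Y) :
    condEntropy (jointYX μ κ) * Real.log 2 = condEnt p κ := by
  have e1 : ∀ b a, jointYX μ κ (b, a) = p a * κ a b := by
    intro b a
    simp only [jointYX, joint, hμ, ← Finset.sum_mul, ← Finset.mul_sum, (hw a).2, mul_one]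
  have e2 : ∀ a, margSnd (jointYX μ κ) a = p a := by
    intro a
    simp only [margSnd, e1, ← Finset.mul_sum, (hκ a).2, mul_one]
  rw [condEntropy_mul_log_two, condEnt]
  · refine Finset.sum_congr rfl fun a _ => ?_
    rw [Finset.mul_sum]
    refine Finset.sum_congr rfl fun b _ => ?_
    rw [condDist, e1, e2]
    by_cases h : p a = 0
    · simp [h]
    · rw [mul_div_cancel_left₀ _ h, Real.negMulLog]; ring
  · rintro ⟨b, a⟩
    rw [e1]
    exact mul_nonneg (hp.1 _) ((hκ _).1 _)

end Rate

namespace CodeFamily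

variable {X Y Z W : Type*} [Fintype X] [Fintype Y] [Fintype Z]
  {μ : X × Z → ℝ} {κ : X → Y → ℝ} {εA εB : ℝ}

theorem rate_bound [Nontrivial Y] (hμ : μ ∈ stdSimplex ℝ (X × Z)) (hκ : ∀ x, κ x ∈ stdSimplex ℝ Y)
    (C : CodeFamily μ κ εA εB) {n : ℕ} (hn : 0 < n) :
    |C.rate n - (wzInfo μ κ + εB)| < Real.logb 2 (Fintype.card Y) / n ∧
    ((∃ k : ℕ, (k : ℝ) = n * (wzInfo μ κ + εB) / Real.logb 2 (Fintype.card Y)) →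
      C.rate n = wzInfo μ κ + εB) := by
  have hn' : (0 : ℝ) < n := by exact_mod_cast hn
  have hY : (1 : ℝ) < Fintype.card Y := by exact_mod_cast Fintype.one_lt_card
  have hl : 0 < Real.logb 2 (Fintype.card Y) := Real.logb_pos (by norm_num) hY
  have h1 := C.lenB_spec n
  rw [← wzInfo_eq hμ hκ] at h1
  set lq := Real.logb 2 (Fintype.card Y)
  set r := wzInfo μ κ + εB
  have e : C.rate n - r = (C.lenB n - n * r / lq) * (lq / n) := by
    rw [rate]; field_simp; rfl
  refine ⟨?_, ?_⟩
  · rw [e, abs_mul, abs_of_pos (div_pos hl hn')]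
    exact (mul_lt_iff_lt_one_left (div_pos hl hn')).2 h1
  · rintro ⟨k, hk⟩
    rw [← hk] at h1
    have h2 : |(C.lenB n : ℤ) - (k : ℤ)| < 1 := by exact_mod_cast h1
    have h3 : (C.lenB n : ℤ) = k := by
      have := Int.abs_lt_one_iff.1 h2
      linarith
    have h4 : (C.lenB n : ℝ) = k := by exact_mod_cast h3
    rw [← sub_eq_zero, e, h4, hk, sub_self, zero_mul]

/-- Rounding costs at most one letter, `log |Y|`. The last clause isolates the degenerate case: a
natural number at distance less than one from `0` is `0`. -/
theorem lenA_mul_log [Nontrivial Y] (C : CodeFamily μ κ εA εB) (n : ℕ) :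
    n * ((condEntropy (jointYX μ κ) - εA) * Real.log 2) - Real.log (Fintype.card Y) ≤
      C.lenA n * Real.log (Fintype.card Y) ∧
    C.lenA n * Real.log (Fintype.card Y) ≤
      max (n * ((condEntropy (jointYX μ κ) - εA) * Real.log 2)) 0 +
        Real.log (Fintype.card Y) ∧
    (condEntropy (jointYX μ κ) ≤ εA → C.lenA n = 0) := by
  have hY : (1 : ℝ) < Fintype.card Y := by exact_mod_cast Fintype.one_lt_card
  have hl : 0 < Real.log (Fintype.card Y) := Real.log_pos hY
  have hL : 0 < Real.log 2 := Real.log_pos (by norm_num)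
  have h1 := C.lenA_spec n
  set h := condEntropy (jointYX μ κ)
  have e : n * (h - εA) / Real.logb 2 (Fintype.card Y) =
      n * ((h - εA) * Real.log 2) / Real.log (Fintype.card Y) := by
    rw [Real.logb]; field_simp
  rw [e] at h1
  set l := Real.log (Fintype.card Y)
  set u := n * ((h - εA) * Real.log 2)
  have e2 : max (u / l) 0 * l = max u 0 := by
    rw [max_mul_of_nonneg _ _ hl.le, div_mul_cancel₀ _ hl.ne', zero_mul]
  obtain ⟨h2, h3⟩ := abs_lt.1 h1
  have h4 := mul_lt_mul_of_pos_right h2 hl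
  have h5 := mul_lt_mul_of_pos_right h3 hl
  rw [sub_mul, e2] at h4 h5
  have h6 := le_max_left u 0
  refine ⟨by linarith, by linarith, fun hle => ?_⟩
  have hu : u ≤ 0 := mul_nonpos_of_nonneg_of_nonpos (Nat.cast_nonneg _)
    (mul_nonpos_of_nonpos_of_nonneg (by linarith) hL.le)
  rw [max_eq_right (div_nonpos_of_nonpos_of_nonneg hu hl.le), sub_zero] at h3
  have : C.lenA n < 1 := by exact_mod_cast h3
  omega

theorem lenB_mul_log [Nontrivial Y] (C : CodeFamily μ κ εA εB) (n : ℕ) :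
    n * ((condEntropy (jointYZ μ κ) - condEntropy (jointYX μ κ) + εB) * Real.log 2) -
      Real.log (Fintype.card Y) ≤ C.lenB n * Real.log (Fintype.card Y) := by
  have hY : (1 : ℝ) < Fintype.card Y := by exact_mod_cast Fintype.one_lt_card
  have hl : 0 < Real.log (Fintype.card Y) := Real.log_pos hY
  have hL : 0 < Real.log 2 := Real.log_pos (by norm_num)
  have h1 := C.lenB_spec n
  set h := condEntropy (jointYZ μ κ) - condEntropy (jointYX μ κ) + εB
  have e : n * h / Real.logb 2 (Fintype.card Y) =
      n * (h * Real.log 2) / Real.log (Fintype.card Y) := by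
    rw [Real.logb]; field_simp
  rw [e] at h1
  have h4 := mul_lt_mul_of_pos_right (abs_lt.1 h1).1 hl
  rw [sub_mul, div_mul_cancel₀ _ hl.ne'] at h4
  linarith

end CodeFamily

/-! ### Letting the block length grow. -/

/-- The first clause of the hash property says that `Im` fills its target up to a subexponential
factor. -/
theorem eventually_le_ncard_im {Y : Type*} [Fintype Y] [Nontrivial Y] {l : ℕ → ℕ}
    {E : ∀ n, Ensemble (Fin n → Y) (Fin (l n) → Y)} {α β : ℕ → ℝ}
    (hE : HasHashPropertyWith E α β) {t : ℝ} (ht : 0 < t) :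
    ∀ᶠ n : ℕ in atTop, Real.exp (l n * Real.log (Fintype.card Y) - n * t) ≤ (E n).im.ncard := by
  have hL : 0 < Real.log 2 := Real.log_pos (by norm_num)
  have hY : (0 : ℝ) < Fintype.card Y := by exact_mod_cast Fintype.card_pos
  filter_upwards [hE.h1.eventually_lt_const (show 0 < t / Real.log 2 by positivity),
    eventually_gt_atTop 0] with n hn hn0
  have hn' : (0 : ℝ) < n := by exact_mod_cast hn0
  have hm : (0 : ℝ) < (E n).im.ncard := by
    rw [← (E n).card_imFinset]; exact_mod_cast (E n).imFinset_card_pos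
  rw [Real.logb, div_div, div_lt_iff₀ (by positivity), Real.log_div (by simp) hm.ne'] at hn
  simp only [Fintype.card_pi_const, Nat.cast_pow, Real.log_pow] at hn
  rw [← Real.le_log_iff_exp_le hm]
  have : t / Real.log 2 * (Real.log 2 * n) = n * t := by field_simp
  linarith

theorem ncard_im_le {Y : Type*} [Fintype Y] [Nonempty Y] {n l : ℕ}
    (E : Ensemble (Fin n → Y) (Fin l → Y)) :
    (E.im.ncard : ℝ) ≤ Real.exp (l * Real.log (Fintype.card Y)) := by
  classical
  have hY : (0 : ℝ) < Fintype.card Y := by exact_mod_cast Fintype.card_pos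
  rw [← Real.log_pow, Real.exp_log (by positivity), ← E.card_imFinset]
  have := Finset.card_le_univ E.imFinset
  rw [Fintype.card_pi_const] at this
  exact_mod_cast this

theorem tendsto_exp_neg_nat_mul {c : ℝ} (hc : 0 < c) :
    Tendsto (fun n : ℕ => Real.exp (-(n * c))) atTop (𝓝 0) :=
  Real.tendsto_exp_neg_atTop_nhds_zero.comp
    (tendsto_natCast_atTop_atTop.atTop_mul_const hc)

theorem tendsto_pow_mul_exp_neg_nat_mul (k : ℕ) {c : ℝ} (hc : 0 < c) :
    Tendsto (fun n : ℕ => ((n : ℝ) + 1) ^ k * Real.exp (-(n * c))) atTop (𝓝 0) := by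
  have h1 := tendsto_pow_const_mul_const_pow_of_abs_lt_one k
    (r := Real.exp (-c)) (by rw [abs_of_pos (Real.exp_pos _)]; exact (Real.exp_lt_exp.2 (neg_lt_zero.2 hc)).trans_eq Real.exp_zero)
  have h2 := ((tendsto_add_atTop_iff_nat 1).2 h1).mul_const (Real.exp c)
  rw [zero_mul] at h2
  refine h2.congr fun n => ?_
  rw [← Real.exp_nat_mul, mul_assoc, ← Real.exp_add]
  push_cast
  congr 2
  ring

section Asymptotics

variable {X Y Z W : Type*} [Fintype X] [Fintype Y] [Fintype Z] {μ : X × Z → ℝ} {κ : X → Y → ℝ}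

theorem HasHashPropertyWith.hashBound {U : Type*} {V : ℕ → Type*} [∀ n, Fintype (V n)]
    {E : ∀ n, Ensemble (Fin n → U) (V n)} {α β : ℕ → ℝ} (h : HasHashPropertyWith E α β) (n : ℕ)
    [DecidableEq (Fin n → U)] : (E n).HashBound (α n) (β n) := by
  intro T T'
  convert h.h4 n T T'

/-- The choice of the typicality parameter. -/
theorem exists_typicality_parameter [Nontrivial Y] [Nonempty Z] (ρ : X → W → ℝ) (f : Y → Z → W)
    {εA εB M R : ℝ} (hA : 0 < εA) (hAB : εA + 2 * zeta (Y × Z) (3 * εA) < εB) (hR : 0 ≤ R) :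
    ∃ t : ℝ, 0 < t ∧ Fintype.card X * (t * M) + t < εA * Real.log 2 ∧
      infoBound μ κ (εA * Real.log 2) t M √εA + t + εA * Real.log 2 <
        (condEntropy (jointYZ μ κ) + εB) * Real.log 2 ∧
      distBound μ κ ρ f (εA * Real.log 2) t M R ≤ expDistortion μ κ ρ f + R * (2 * √εA) := by
  have hL : 0 < Real.log 2 := Real.log_pos (by norm_num)
  have hL1 : Real.log 2 < 1 := by linarith [Real.log_two_lt_d9]
  have hs : 0 < √εA := Real.sqrt_pos.2 hA
  set e := εA * Real.log 2 with he
  have he0 : 0 < e := by positivity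
  have hse : √e < √εA := Real.sqrt_lt_sqrt he0.le (by nlinarith)
  have hK : (2 : ℝ) ≤ Fintype.card (Y × Z) := by
    rw [Fintype.card_prod]
    have h1 : 2 ≤ Fintype.card Y := Fintype.one_lt_card
    have h2 : 1 ≤ Fintype.card Z := Fintype.card_pos
    exact_mod_cast (by nlinarith : 2 ≤ Fintype.card Y * Fintype.card Z)
  have hz := zeta_bound hK hs
  rw [Real.sq_sqrt hA.le] at hz
  have hd0 : divBound X e 0 M = e := by simp [divBound]
  have c1 : Continuous fun t : ℝ => Fintype.card X * (t * M) + t := by fun_prop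
  have c2 : Continuous fun t : ℝ => infoBound μ κ e t M √εA + t + e := by
    unfold infoBound divBound; fun_prop
  have c3 : Continuous fun t : ℝ =>
      √(divBound X e t M) + (Fintype.card (X × Y × Z) + Fintype.card X) * t := by
    unfold divBound; fun_prop
  -- All three requirements hold strictly at `t = 0`, hence for some small `t > 0` by continuity.
  have v1 := (c1.tendsto 0).eventually_lt_const (u := e) (by simpa using he0)
  -- The slack `e` counts twice: as divergence in `infoBound`, and through the shortened length of
  -- `A`. One copy is the `εA` in the hypothesis, the other is absorbed by `zeta_bound`.
  have v2 := (c2.tendsto 0).eventually_lt_const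
    (u := (condEntropy (jointYZ μ κ) + εB) * Real.log 2) (by
      have h1 := mul_lt_mul_of_pos_right hAB hL
      have h2 := mul_le_mul_of_nonneg_right hse.le
        (le_max_right (Real.log (Fintype.card (Y × Z) / √εA)) 0)
      simp only [infoBound, hd0, zero_mul, mul_zero, add_zero]
      rw [zeta] at h1
      linarith)
  have v3 := (c3.tendsto 0).eventually_lt_const (u := 2 * √εA) (by
      simp only [hd0, mul_zero, add_zero]; linarith)
  obtain ⟨t, ⟨⟨h1, h2⟩, h3⟩, h0⟩ := ((((v1.and v2).and v3).filter_mono nhdsWithin_le_nhds).and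
    (self_mem_nhdsWithin : Set.Ioi (0 : ℝ) ∈ 𝓝[>] 0)).exists
  refine ⟨t, h0, h1, h2, ?_⟩
  have := mul_le_mul_of_nonneg_left h3.le hR
  rw [distBound]
  linarith

open Classical in
/-- The bound for the probability of an encoding failure. -/
theorem sum_codeWeight_entTyp_le [Nontrivial Y] {p : X → ℝ} {t M e h : ℝ} {n l : ℕ} {VB : Type*}
    [Finite VB] (hn : 0 < n) (hκ : ∀ x, κ x ∈ stdSimplex ℝ Y)
    (hM : ∀ a b, |Real.log (κ a b)| ≤ M) (ht : 0 < t) (hnt : M ^ 2 / (n * t ^ 2) ≤ 1 / 2)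
    (hh : condEnt p κ = h)
    (EA : Ensemble (Fin n → Y) (Fin l → Y)) (EB : Ensemble (Fin n → Y) VB)
    {α β : ℝ} (hE : EA.HashBound α β)
    (hl : l * Real.log (Fintype.card Y) ≤ max (n * (h - e)) 0 + Real.log (Fintype.card Y))
    (hl0 : h ≤ e → l = 0) {x : Fin n → X} (hx : TypX p t x) :
    ∑ q ∈ codeSet EA EB, codeWeight EA EB q *
      (if ∀ v ∈ entTyp κ t x, q.1 v ≠ q.2.2 then (1 : ℝ) else 0) ≤
    |α - 1| + (1 + |β|) * (2 * Fintype.card Y *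
      Real.exp (-(n * (e - (Fintype.card X * (t * M) + t))))) := by
  have hY : (0 : ℝ) < Fintype.card Y := by exact_mod_cast Fintype.card_pos
  have hcard := le_card_entTyp hn hκ x hM ht hnt
  have hpos : (0 : ℝ) < (entTyp κ t x).card := lt_of_lt_of_le (by positivity) hcard
  have hne : (entTyp κ t x).Nonempty := Finset.card_pos.1 (by exact_mod_cast hpos)
  rcases le_or_gt h e with hhe | hhe
  -- When `H(Y|X) ≤ εA` the length is `0`: there is a single bin, which contains every sequence.
  · have hl' := hl0 hhe
    subst hl'
    obtain ⟨v, hv⟩ := hne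
    rw [Finset.sum_eq_zero]
    · positivity
    · intro q _
      rw [if_neg, mul_zero]
      exact fun hq => hq v hv (Subsingleton.elim _ _)
  · have hemp := sum_codeWeight_empty_le EA EB hE _ hne
    simp only [ne_eq] at hemp ⊢
    refine (le_of_eq (by congr!)).trans (hemp.trans ?_)
    rw [max_eq_left (mul_nonneg (Nat.cast_nonneg _) (by linarith))] at hl
    refine add_le_add (le_abs_self _) ?_
    have h1 : (EA.im.ncard : ℝ) ≤ Real.exp (n * (h - e)) * Fintype.card Y := by
      refine (ncard_im_le EA).trans ((Real.exp_le_exp.2 hl).trans (le_of_eq ?_))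
      rw [Real.exp_add, Real.exp_log hY]
    have h2 : Real.exp (n * (h - (Fintype.card X * (t * M) + t))) / 2 ≤ (entTyp κ t x).card := by
      refine le_trans ?_ hcard
      have b2 := hx.abs_sum_sub_le (g := fun a => ∑ b, Real.negMulLog (κ a b)) (G := M)
        (fun a => by
          have := abs_sum_mul_le (g := fun b => -Real.log (κ a b)) (hκ a) fun b => by
            rw [abs_neg]; exact hM a b
          simpa [Real.negMulLog] using this)
      have b3 := (abs_le.1 b2).1
      rw [← condEnt, hh] at b3
      have : Real.exp (n * (h - (Fintype.card X * (t * M) + t))) ≤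
        Real.exp (∑ i, ∑ b, Real.negMulLog (κ (x i) b) - t * n) :=
          Real.exp_le_exp.2 (by linarith)
      linarith
    rw [div_le_iff₀ hpos]
    calc (EA.im.ncard : ℝ) * (1 + β) ≤ (Real.exp (n * (h - e)) * Fintype.card Y) * (1 + |β|) := by
          refine (mul_le_mul_of_nonneg_left (add_le_add_right (le_abs_self β) 1)
            (Nat.cast_nonneg _)).trans (mul_le_mul_of_nonneg_right h1 (by positivity))
      _ = (1 + |β|) * (2 * Fintype.card Y *
            Real.exp (-(n * (e - (Fintype.card X * (t * M) + t))))) *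
            (Real.exp (n * (h - (Fintype.card X * (t * M) + t))) / 2) := by
          have : Real.exp (n * (h - e)) = Real.exp (-(n * (e - (Fintype.card X * (t * M) + t)))) *
            Real.exp (n * (h - (Fintype.card X * (t * M) + t))) := by
              rw [← Real.exp_add]; congr 1; ring
          rw [this]; ring
      _ ≤ _ := mul_le_mul_of_nonneg_left h2 (by positivity)

/-- The distortion guarantee. -/
theorem eventually_exists_distortion_le [Nontrivial Y] [Nonempty Z]
    (hμ : μ ∈ stdSimplex ℝ (X × Z)) (hκ : ∀ x, κ x ∈ stdSimplex ℝ Y)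
    {ρ : X → W → ℝ} (hρ : ∀ x w, 0 ≤ ρ x w) {R : ℝ} (hR : ∀ x w, ρ x w ≤ R) (hR0 : 0 ≤ R)
    (f : Y → Z → W) {εA εB : ℝ} (hA : 0 < εA)
    (hAB : εA + 2 * zeta (Y × Z) (3 * εA) < εB) (C : CodeFamily μ κ εA εB)
    (hCA : HasHashProperty C.ensA) (hCB : HasHashProperty C.ensB) :
    ∀ᶠ n : ℕ in atTop, ∃ A ∈ (C.ensA n).carrier, ∃ B ∈ (C.ensB n).carrier,
      ∃ c ∈ (C.ensA n).im, C.distortion ρ f A B c ≤ expDistortion μ κ ρ f + R * (3 * √εA) := by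
  classical
  obtain ⟨p, hp, w, hw, hpw⟩ := exists_disintegration hμ
  obtain ⟨αA, βA, hEA⟩ := hCA
  obtain ⟨αB, βB, hEB⟩ := hCB
  have hL : 0 < Real.log 2 := Real.log_pos (by norm_num)
  have hY : (0 : ℝ) < Fintype.card Y := by exact_mod_cast Fintype.card_pos
  -- A finite bound on all log-likelihoods; zero probabilities contribute nothing since `log 0 = 0`.
  set M := ∑ a, ∑ b, |Real.log (κ a b)| +
    ∑ d, ∑ b, |Real.log (condDist (jointYZ μ κ) d b)| with hMdef
  have hM : ∀ a b, |Real.log (κ a b)| ≤ M := fun a b => by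
    have h1 := Finset.single_le_sum (f := fun b => |Real.log (κ a b)|)
      (fun _ _ => abs_nonneg _) (Finset.mem_univ b)
    have h2 := Finset.single_le_sum (f := fun a => ∑ b, |Real.log (κ a b)|)
      (fun _ _ => Finset.sum_nonneg fun _ _ => abs_nonneg _) (Finset.mem_univ a)
    have h3 : 0 ≤ ∑ d, ∑ b, |Real.log (condDist (jointYZ μ κ) d b)| :=
      Finset.sum_nonneg fun _ _ => Finset.sum_nonneg fun _ _ => abs_nonneg _
    linarith
  have hM' : ∀ d b, |Real.log (condDist (jointYZ μ κ) d b)| ≤ M := fun d b => by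
    have h1 := Finset.single_le_sum (f := fun b => |Real.log (condDist (jointYZ μ κ) d b)|)
      (fun _ _ => abs_nonneg _) (Finset.mem_univ b)
    have h2 := Finset.single_le_sum (f := fun d => ∑ b, |Real.log (condDist (jointYZ μ κ) d b)|)
      (fun _ _ => Finset.sum_nonneg fun _ _ => abs_nonneg _) (Finset.mem_univ d)
    have h3 : 0 ≤ ∑ a, ∑ b, |Real.log (κ a b)| :=
      Finset.sum_nonneg fun _ _ => Finset.sum_nonneg fun _ _ => abs_nonneg _
    linarith
  obtain ⟨t, ht, ht1, ht2, ht3⟩ := exists_typicality_parameter (μ := μ) (κ := κ) (M := M)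
    ρ f hA hAB hR0
  set e := εA * Real.log 2 with he
  have hent := condEntropy_jointYX hpw hp hw hκ
  set S := infoBound μ κ e t M √εA with hS
  -- `c₂` and `c₅` are the decay exponents of encoding failure and of decoding collisions, positive
  -- by the choice of `t`. Each image size gives up `t / 2`, hence the `t` in `c₅`.
  set c₂ := e - (Fintype.card X * (t * M) + t) with hc2
  set c₅ := (condEntropy (jointYZ μ κ) + εB) * Real.log 2 - e - S - t with hc5
  set b₁ : ℕ → ℝ := fun n => Fintype.card X / (n * t ^ 2)
  set b₂ : ℕ → ℝ := fun n => |αA n - 1| + (1 + |βA n|) *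
    (2 * Fintype.card Y * Real.exp (-(n * c₂)))
  set b₃ : ℕ → ℝ := fun n => Fintype.card Y * (((n : ℝ) + 1) ^ (Fintype.card X * Fintype.card Y) *
    Real.exp (-(n * (t / 2))))
  set b₄ : ℕ → ℝ := fun n => Fintype.card (X × Y × Z) / (n * t ^ 2)
  set b₅ : ℕ → ℝ := fun n => Fintype.card Y ^ 2 * |αB n| * Real.exp (-(n * c₅)) + |βB n|
  have tend_inv : ∀ K : ℝ, Tendsto (fun n : ℕ => K / (n * t ^ 2)) atTop (𝓝 0) := fun K =>
    (tendsto_natCast_atTop_atTop.atTop_mul_const (by positivity)).const_div_atTop K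
  have tend2 : Tendsto b₂ atTop (𝓝 0) := by
    have h1 := (hEA.h2.sub_const 1).abs
    have h2 := ((hEA.h3.abs.const_add 1).mul
      ((tendsto_exp_neg_nat_mul (c := c₂) (by linarith)).const_mul (2 * (Fintype.card Y : ℝ))))
    simpa using h1.add h2
  have tend3 : Tendsto b₃ atTop (𝓝 0) := by
    simpa using (tendsto_pow_mul_exp_neg_nat_mul (Fintype.card X * Fintype.card Y)
      (half_pos ht)).const_mul (Fintype.card Y : ℝ)
  have tend5 : Tendsto b₅ atTop (𝓝 0) := by
    have h1 := (hEB.h2.abs.const_mul ((Fintype.card Y : ℝ) ^ 2)).mul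
      (tendsto_exp_neg_nat_mul (c := c₅) (by linarith))
    simpa using h1.add hEB.h3.abs
  have tend : Tendsto (fun n => b₁ n + b₂ n + b₃ n + b₄ n + b₅ n) atTop (𝓝 0) := by
    simpa using ((((tend_inv _).add tend2).add tend3).add (tend_inv _)).add tend5
  -- The total error bound falls below `√εA`; with the `2 * √εA` in `distBound` this makes the final
  -- factor 3.
  filter_upwards [tend.eventually_lt_const (Real.sqrt_pos.2 hA), eventually_gt_atTop 0,
    (tend_inv (M ^ 2)).eventually_lt_const (show (0 : ℝ) < 1 / 2 by norm_num),
    eventually_le_ncard_im hEA (half_pos ht), eventually_le_ncard_im hEB (half_pos ht)]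
    with n hb hn hnt hmA hmB
  have hn' : (0 : ℝ) < n := by exact_mod_cast hn
  obtain ⟨hlA1, hlA2, hlA3⟩ := C.lenA_mul_log n
  have hlB := C.lenB_mul_log n
  have eA : (condEntropy (jointYX μ κ) - εA) * Real.log 2 = condEnt p κ - e := by
    rw [sub_mul, hent]
  have eB : (condEntropy (jointYZ μ κ) - condEntropy (jointYX μ κ) + εB) * Real.log 2 =
      (condEntropy (jointYZ μ κ) + εB) * Real.log 2 - condEnt p κ := by
    rw [← hent]; ring
  rw [eA] at hlA1 hlA2
  rw [eB] at hlB
  set lq := Real.log (Fintype.card Y) with hlq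
  have hmA' : Real.exp (n * (condEnt p κ - e) - lq - n * (t / 2)) ≤ (C.ensA n).im.ncard :=
    le_trans (Real.exp_le_exp.2 (by linarith)) hmA
  have hmB' : Real.exp (n * ((condEntropy (jointYZ μ κ) + εB) * Real.log 2 - condEnt p κ) - lq -
      n * (t / 2)) ≤ (C.ensB n).im.ncard :=
    le_trans (Real.exp_le_exp.2 (by linarith)) hmB
  have hmA0 : (0 : ℝ) < (C.ensA n).im.ncard := lt_of_lt_of_le (Real.exp_pos _) hmA'
  have hmB0 : (0 : ℝ) < (C.ensB n).im.ncard := lt_of_lt_of_le (Real.exp_pos _) hmB'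
  have h2 : ∀ x : Fin n → X, TypX p t x → ∑ q ∈ codeSet (C.ensA n) (C.ensB n),
      codeWeight (C.ensA n) (C.ensB n) q *
      (if ∀ v ∈ entTyp κ t x, q.1 v ≠ q.2.2 then (1 : ℝ) else 0) ≤ b₂ n := fun x hx => by
    refine (le_of_eq (by congr!)).trans (sum_codeWeight_entTyp_le hn hκ hM ht hnt.le rfl
      (C.ensA n) (C.ensB n) (hEA.hashBound n) hlA2 (fun h => hlA3 ?_) hx)
    rw [← hent] at h
    exact le_of_mul_le_mul_right h hL
  have h3 : ∀ x : Fin n → X, ((lowEntropySet κ (condEnt p κ - e - t) x).card : ℝ) /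
      (C.ensA n).im.ncard ≤ b₃ n := fun x => by
    rw [div_le_iff₀ hmA0]
    refine (card_empEntropy_le hκ x _).trans ?_
    calc _ = b₃ n * Real.exp (n * (condEnt p κ - e) - lq - n * (t / 2)) := by
          have h1 : (Fintype.card Y : ℝ) = Real.exp lq := (Real.exp_log hY).symm
          have h2 : Real.exp (n * (condEnt p κ - e - t)) = Real.exp lq *
              Real.exp (-(n * (t / 2))) *
              Real.exp (n * (condEnt p κ - e) - lq - n * (t / 2)) := by
            rw [← Real.exp_add, ← Real.exp_add]; congr 1; ring
          rw [h2, ← h1]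
          simp only [b₃]
          ring
      _ ≤ _ := mul_le_mul_of_nonneg_left hmA' (by positivity)
  have h5 : ∀ z : Fin n → Z, ((likelySet (condDist (jointYZ μ κ)) S z).card : ℝ) * |αB n| /
      ((C.ensA n).im.ncard * (C.ensB n).im.ncard) + |βB n| ≤ b₅ n := fun z => by
    refine add_le_add_left ?_ _
    rw [div_le_iff₀ (by positivity)]
    have h1 := card_likelySet_le (condDist_nonneg (jointYZ_mem_stdSimplex hμ hκ).1)
      (sum_condDist_le_one (jointYZ μ κ)) S z
    have h2 := mul_le_mul hmA' hmB' (Real.exp_pos _).le hmA0.le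
    calc _ ≤ Real.exp (n * S) * |αB n| := mul_le_mul_of_nonneg_right h1 (abs_nonneg _)
      _ = Fintype.card Y ^ 2 * |αB n| * Real.exp (-(n * c₅)) *
          (Real.exp (n * (condEnt p κ - e) - lq - n * (t / 2)) *
            Real.exp (n * ((condEntropy (jointYZ μ κ) + εB) * Real.log 2 - condEnt p κ) - lq -
              n * (t / 2))) := by
          have h3 : (Fintype.card Y : ℝ) = Real.exp lq := (Real.exp_log hY).symm
          have h4 : Real.exp (n * S) = Real.exp lq * Real.exp lq * Real.exp (-(n * c₅)) *
              (Real.exp (n * (condEnt p κ - e) - lq - n * (t / 2)) *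
              Real.exp (n * ((condEntropy (jointYZ μ κ) + εB) * Real.log 2 - condEnt p κ) - lq -
              n * (t / 2))) := by
            simp only [← Real.exp_add]; congr 1; rw [hc5]; ring
          rw [h4, ← h3]
          ring
      _ ≤ _ := mul_le_mul_of_nonneg_left h2 (by positivity)
  obtain ⟨A, hA', B, hB', c, hc, hle⟩ := exists_code (e := e) (f := f) hn hpw hμ hp hw hκ hM hM' hρ
    hR hR0 (Real.sqrt_pos.2 hA) ht (C.ensA n) (C.ensB n) (C.gA_spec n) (C.gAB_spec n)
    (hEB.hashBound n) (fun x hx => (le_of_eq (by congr!)).trans (h2 x hx)) (by positivity) h3 h5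
  refine ⟨A, hA', B, hB', c, hc, hle.trans ?_⟩
  have h1 := mul_le_mul_of_nonneg_left hb.le hR0
  simp only [b₁, b₄] at h1
  linarith

end Asymptotics

end WynerZiv

/-! ### The theorem. -/

theorem mainTheorem5 {X Y Z W : Type*} [Fintype X] [Fintype Y] [Fintype Z] [Nontrivial Y]
    (μ : X × Z → ℝ) (hμ : μ ∈ stdSimplex ℝ (X × Z))
    (κ : X → Y → ℝ) (hκ : ∀ x, κ x ∈ stdSimplex ℝ Y)
    (ρ : X → W → ℝ) (hρ : ∀ x w, 0 ≤ ρ x w)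
    (hρmax : BddAbove (Set.range fun p : X × W => ρ p.1 p.2))
    (f : Y → Z → W) :
    (∀ εA εB : ℝ, 0 < εA → 0 < εB → εA + 2 * WynerZiv.zeta (Y × Z) (3 * εA) < εB →
      ∀ C : WynerZiv.CodeFamily μ κ εA εB,
        WynerZiv.HasHashProperty C.ensA → WynerZiv.HasHashProperty C.ensB →
        ∀ᶠ n : ℕ in Filter.atTop, ∃ A ∈ (C.ensA n).carrier, ∃ B ∈ (C.ensB n).carrier,
          ∃ c ∈ (C.ensA n).im, C.Achieves ρ f A B c) ∧
    (∀ D : ℝ, WynerZiv.AttainsWZ μ κ ρ f D → ∀ δ : ℝ, 0 < δ → ∃ η : ℝ, 0 < η ∧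
      ∀ εA εB : ℝ, 0 < εA → εA < η → 0 < εB → εB < η →
        εA + 2 * WynerZiv.zeta (Y × Z) (3 * εA) < εB →
        ∀ C : WynerZiv.CodeFamily μ κ εA εB,
          WynerZiv.HasHashProperty C.ensA → WynerZiv.HasHashProperty C.ensB →
          ∀ᶠ n : ℕ in Filter.atTop, ∃ A ∈ (C.ensA n).carrier, ∃ B ∈ (C.ensB n).carrier,
            ∃ c ∈ (C.ensA n).im, C.Achieves ρ f A B c ∧
              |C.rate n - WynerZiv.wzRate Y μ ρ D| ≤ δ ∧
              C.distortion ρ f A B c ≤ D + δ) := by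
  have hne : Nonempty (X × Z) := by
    by_contra h
    rw [not_nonempty_iff] at h
    have := hμ.2
    simp at this
  have hX : Nonempty X := hne.map Prod.fst
  have hZ : Nonempty Z := hne.map Prod.snd
  have hR : ∀ x w, ρ x w ≤ WynerZiv.rhoMax ρ := fun x w => le_ciSup hρmax (x, w)
  have hR0 : 0 ≤ WynerZiv.rhoMax ρ := Real.iSup_nonneg fun q => hρ _ _
  have part1 : ∀ εA εB : ℝ, 0 < εA → 0 < εB → εA + 2 * WynerZiv.zeta (Y × Z) (3 * εA) < εB →
      ∀ C : WynerZiv.CodeFamily μ κ εA εB,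
        WynerZiv.HasHashProperty C.ensA → WynerZiv.HasHashProperty C.ensB →
        ∀ᶠ n : ℕ in Filter.atTop, ∃ A ∈ (C.ensA n).carrier, ∃ B ∈ (C.ensB n).carrier,
          ∃ c ∈ (C.ensA n).im, C.Achieves ρ f A B c := by
    intro εA εB hA _ hAB C hCA hCB
    filter_upwards [WynerZiv.eventually_exists_distortion_le hμ hκ hρ hR hR0 f hA hAB C hCA hCB,
      eventually_gt_atTop 0] with n h hn
    obtain ⟨A, hA', B, hB', c, hc, hle⟩ := h
    obtain ⟨hr1, hr2⟩ := C.rate_bound hμ hκ hn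
    refine ⟨A, hA', B, hB', c, hc, hr1, hr2, hle.trans (add_le_add_right ?_ _)⟩
    -- The bound proved has no alphabet factor; the stated one is weaker because this product is at
    -- least one.
    have hcard : (1 : ℝ) ≤ Fintype.card X * Fintype.card Y * Fintype.card Z := by
      have h1 : 0 < Fintype.card X * Fintype.card Y * Fintype.card Z :=
        Nat.mul_pos (Nat.mul_pos Fintype.card_pos Fintype.card_pos) Fintype.card_pos
      exact_mod_cast h1
    have h0 : 0 ≤ WynerZiv.rhoMax ρ * (3 * √εA) := by positivity
    have := mul_le_mul_of_nonneg_right hcard h0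
    linarith
  refine ⟨part1, fun D hD δ hδ => ?_⟩
  set K : ℝ := 3 * Fintype.card X * Fintype.card Y * Fintype.card Z * WynerZiv.rhoMax ρ with hK
  have hK0 : 0 ≤ K := by positivity
  -- `δ / 2` covers `εB` and leaves `δ / 2` for rounding, while the square gives `K * √εA ≤ δ`.
  -- Using `K + 1` avoids dividing by zero when `ρ` vanishes.
  refine ⟨min (δ / 2) ((δ / (K + 1)) ^ 2), by positivity, ?_⟩
  intro εA εB hA hAη hB hBη hAB C hCA hCB
  have hlim : Tendsto (fun n : ℕ => Real.logb 2 (Fintype.card Y) / (n : ℝ)) atTop (𝓝 0) :=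
    tendsto_natCast_atTop_atTop.const_div_atTop _
  filter_upwards [part1 εA εB hA hB hAB C hCA hCB, hlim.eventually_lt_const (half_pos hδ)]
    with n h hn
  obtain ⟨A, hA', B, hB', c, hc, hach⟩ := h
  refine ⟨A, hA', B, hB', c, hc, hach, ?_, ?_⟩
  · have h1 := abs_lt.1 hach.1
    rw [← hD.2]
    have h2 := hBη.trans_le (min_le_left _ _)
    exact abs_le.2 ⟨by linarith, by linarith⟩
  · refine hach.2.2.trans (add_le_add hD.1 ?_)
    have h1 : √εA ≤ δ / (K + 1) :=
      (Real.sqrt_le_left (by positivity)).2 (hAη.le.trans (min_le_right _ _))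
    calc K * √εA ≤ (K + 1) * (δ / (K + 1)) :=
          mul_le_mul (by linarith) h1 (Real.sqrt_nonneg _) (by linarith)
      _ = δ := by field_simp
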